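/- Let $q\in L^1(\mathbb R)$ be real-valued and suppose that there is a constant $q_m\ge 0$ such that $q(x)+q_m e^{-x^2}\ge 0$ for almost every $x\in\mathbb R$. Let $H=-\frac{d^2}{dx^2}+V$, with $V(x)=x^2+q(x)$, be the operator on $L^2(\mathbb R)$ associated with the quadratic form $u\mapsto\int_{\mathbb R}(u')^2\,dx+\int_{\mathbb R}Vu^2\,dx$ on $H^1(\mathbb R)\cap L^2(\mathbb R,V(x)\,dx)$. Then the eigenvalues of $H$, repeated according to their (finite) multiplicities, form a sequence $\lambda_0\le\lambda_1\le\cdots\to\infty$, and, with $\lambda_k^0=2k+1$, $$\sum_{k=0}^{n}\left[\lambda_k-\lambda_k^0-\frac{1}{\pi\sqrt{\lambda_k^0}}\int_{\mathbb R}q(x)\,dx\right]\le\frac{\chi_n}{\pi}\int_{\mathbb R}q(x)\,dx+\varepsilon_n\frac{q_m}{\sqrt\pi},\qquad n=0,1,2,\ldots,$$ where $$\chi_n=\begin{cases}\dfrac{2n+3}{n+1}\,\dfrac{\Gamma(\frac n2+1)}{\Gamma(\frac{n+1}2)}-\displaystyle\sum_{k=0}^n\frac1{\sqrt{\lambda_k^0}},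 & n\text{ odd},\\[3mm](n+1)\,\dfrac{\Gamma(\frac{n+1}2)}{\Gamma(\frac n2+1)}-\displaystyle\sum_{k=0}^n\frac1{\sqrt{\lambda_k^0}}, & n\text{ even},\end{cases}\qquad \omega_n=\chi_n+\sum_{k=0}^n\frac1{\sqrt{\lambda_k^0}},$$ $$\varepsilon_n=\omega_n-\sqrt2\,\frac{\Gamma(n+\frac32)}{\Gamma(n+1)}.$$ Moreover $\varepsilon_n\ge 0$ for all $n\ge 0$, and $\varepsilon_n=O(1/\sqrt n)$ as $n\to\infty$. -/

import Mathlib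

open MeasureTheory Filter Topology Asymptotics
open scoped ContDiff

noncomputable section

namespace PerturbedOscillator

/-- The real Hilbert space `L²(ℝ)` with respect to Lebesgue measure. -/
abbrev L2 : Type := Lp ℝ 2 (volume : Measure ℝ)

/-- `g ∈ L²(ℝ)` is the weak derivative of `u ∈ L²(ℝ)`:
`∫ u φ' = -∫ g φ` for all real test functions `φ ∈ C_c^∞(ℝ)`.
A function `u ∈ L²(ℝ)` is in `H¹(ℝ)` iff such a `g` exists, and then `g` is unique. -/
def IsWeakDeriv (u g : L2) : Prop :=
  ∀ φ : ℝ → ℝ, ContDiff ℝ ∞ φ → HasCompactSupport φ →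
    ∫ x, u x * deriv φ x = -∫ x, g x * φ x

lemma integrable_mul_of_memLp (u : L2) {f : ℝ → ℝ} (hf : Continuous f)
    (hc : HasCompactSupport f) : Integrable (fun x => u x * f x) :=
  (Lp.memLp u).integrable_mul (q := 2) (hf.memLp_of_hasCompactSupport hc)

lemma integrable_mul_L2 (u v : L2) : Integrable (fun x => u x * v x) :=
  (Lp.memLp u).integrable_mul (q := 2) (Lp.memLp v)

lemma IsWeakDeriv.zero : IsWeakDeriv 0 0 := by
  intro φ _ _
  have h0 : ((0 : L2) : ℝ → ℝ) =ᵐ[volume] 0 := Lp.coeFn_zero ℝ 2 volume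
  have h1 : ∫ x, (0 : L2) x * deriv φ x = 0 := by
    rw [← integral_zero ℝ ℝ (μ := volume)]
    refine integral_congr_ae ?_
    filter_upwards [h0] with x hx
    simp
  have h2 : ∫ x, (0 : L2) x * φ x = 0 := by
    rw [← integral_zero ℝ ℝ (μ := volume)]
    refine integral_congr_ae ?_
    filter_upwards [h0] with x hx
    simp
  rw [h1, h2, neg_zero]

lemma IsWeakDeriv.add {u v g h : L2} (hu : IsWeakDeriv u g) (hv : IsWeakDeriv v h) :
    IsWeakDeriv (u + v) (g + h) := by
  intro φ hφ hc
  have hd : Continuous (deriv φ) := hφ.continuous_deriv (by simp)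
  have e1 : ∫ x, (u + v : L2) x * deriv φ x
      = (∫ x, u x * deriv φ x) + ∫ x, v x * deriv φ x := by
    rw [← integral_add (integrable_mul_of_memLp u hd hc.deriv)
      (integrable_mul_of_memLp v hd hc.deriv)]
    refine integral_congr_ae ?_
    filter_upwards [Lp.coeFn_add u v] with x hx
    simp only [hx, Pi.add_apply, add_mul]
  have e2 : ∫ x, (g + h : L2) x * φ x = (∫ x, g x * φ x) + ∫ x, h x * φ x := by
    rw [← integral_add (integrable_mul_of_memLp g hφ.continuous hc)
      (integrable_mul_of_memLp h hφ.continuous hc)]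
    refine integral_congr_ae ?_
    filter_upwards [Lp.coeFn_add g h] with x hx
    simp only [hx, Pi.add_apply, add_mul]
  rw [e1, e2, hu φ hφ hc, hv φ hφ hc]
  ring

lemma IsWeakDeriv.smul {u g : L2} (c : ℝ) (hu : IsWeakDeriv u g) :
    IsWeakDeriv (c • u) (c • g) := by
  intro φ hφ hc
  have e1 : ∫ x, (c • u : L2) x * deriv φ x = c * ∫ x, u x * deriv φ x := by
    rw [← integral_const_mul]
    refine integral_congr_ae ?_
    filter_upwards [Lp.coeFn_smul c u] with x hx
    simp [hx, mul_assoc]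
  have e2 : ∫ x, (c • g : L2) x * φ x = c * ∫ x, g x * φ x := by
    rw [← integral_const_mul]
    refine integral_congr_ae ?_
    filter_upwards [Lp.coeFn_smul c g] with x hx
    simp [hx, mul_assoc]
  rw [e1, e2, hu φ hφ hc]
  ring

lemma integrable_potential_mul {V u v : ℝ → ℝ} (mu : AEStronglyMeasurable u volume)
    (mv : AEStronglyMeasurable v volume) (hu : Integrable (fun x => V x * u x ^ 2))
    (hv : Integrable (fun x => V x * v x ^ 2)) : Integrable (fun x => V x * (u x * v x)) := by
  have hm : AEStronglyMeasurable (fun x => V x * (u x * v x)) volume := by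
    have h : AEMeasurable (fun x => (V x * u x ^ 2) * (v x / u x)) volume :=
      hu.aestronglyMeasurable.aemeasurable.mul (mv.aemeasurable.div mu.aemeasurable)
    refine h.aestronglyMeasurable.congr (Eventually.of_forall fun x => ?_)
    by_cases h0 : u x = 0
    · simp [h0]
    · simp only
      field_simp
  refine (hu.norm.add hv.norm).mono' hm (Eventually.of_forall fun x => ?_)
  simp only [Pi.add_apply, Real.norm_eq_abs, abs_mul, abs_pow]
  nlinarith [mul_nonneg (abs_nonneg (V x)) (sq_nonneg (|u x| - |v x|)),
    mul_nonneg (abs_nonneg (V x)) (add_nonneg (sq_nonneg |u x|) (sq_nonneg |v x|))]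

/-- The form domain `H¹(ℝ) ∩ L²(ℝ, V dx)` of `-d²/dx² + V`. -/
def formDomain (V : ℝ → ℝ) : Submodule ℝ L2 where
  carrier := {u | (∃ g : L2, IsWeakDeriv u g) ∧ Integrable (fun x => V x * u x ^ 2)}
  zero_mem' := by
    refine ⟨⟨0, IsWeakDeriv.zero⟩, ?_⟩
    refine (integrable_zero ℝ ℝ volume).congr ?_
    filter_upwards [Lp.coeFn_zero ℝ 2 (volume : Measure ℝ)] with x hx
    simp
  add_mem' := by
    rintro u v ⟨⟨g, hg⟩, hu⟩ ⟨⟨h, hh⟩, hv⟩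
    refine ⟨⟨g + h, hg.add hh⟩, ?_⟩
    have huv := integrable_potential_mul (Lp.aestronglyMeasurable u)
      (Lp.aestronglyMeasurable v) hu hv
    refine ((hu.add (huv.const_mul 2)).add hv).congr ?_
    filter_upwards [Lp.coeFn_add u v] with x hx
    simp only [Pi.add_apply, hx]
    ring
  smul_mem' := by
    rintro c u ⟨⟨g, hg⟩, hu⟩
    refine ⟨⟨c • g, hg.smul c⟩, ?_⟩
    refine (hu.const_mul (c ^ 2)).congr ?_
    filter_upwards [Lp.coeFn_smul c u] with x hx
    simp only [hx, Pi.smul_apply, smul_eq_mul]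
    ring

/-- The graph of the operator `H = -d²/dx² + V` on `L²(ℝ)`, as the operator associated with the
quadratic form `∫ (u')² + ∫ V u²` on `H¹(ℝ) ∩ L²(ℝ, V dx)`: the pair `(u, f)` lies in the graph
(that is, `u ∈ D(H)` and `H u = f`) iff `u` is in the form domain and
`∫ u' v' + ∫ V u v = ∫ f v` for every `v` in the form domain. -/
def schrodingerGraph (V : ℝ → ℝ) : Submodule ℝ (L2 × L2) where
  carrier := {p | p.1 ∈ formDomain V ∧ ∃ g : L2, IsWeakDeriv p.1 g ∧
    ∀ v ∈ formDomain V, ∀ h : L2, IsWeakDeriv v h →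
      (∫ x, g x * h x) + ∫ x, V x * (p.1 x * v x) = ∫ x, p.2 x * v x}
  zero_mem' := by
    refine ⟨(formDomain V).zero_mem, 0, IsWeakDeriv.zero, fun v _ h _ => ?_⟩
    have h0 : ((0 : L2) : ℝ → ℝ) =ᵐ[volume] 0 := Lp.coeFn_zero ℝ 2 volume
    have z : ∀ w : L2, ∫ x, (0 : L2) x * w x = 0 := fun w => by
      rw [← integral_zero ℝ ℝ (μ := volume)]
      refine integral_congr_ae ?_
      filter_upwards [h0] with x hx
      simp
    have z' : ∫ x, V x * ((0 : L2) x * v x) = 0 := by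
      rw [← integral_zero ℝ ℝ (μ := volume)]
      refine integral_congr_ae ?_
      filter_upwards [h0] with x hx
      simp
    simp only [Prod.fst_zero, Prod.snd_zero]
    rw [z h, z v, z', add_zero]
  add_mem' := by
    rintro ⟨u₁, f₁⟩ ⟨u₂, f₂⟩ ⟨m₁, g₁, d₁, e₁⟩ ⟨m₂, g₂, d₂, e₂⟩
    refine ⟨(formDomain V).add_mem m₁ m₂, g₁ + g₂, d₁.add d₂, fun v hv h hh => ?_⟩
    have a : ∀ p q w : L2, ∫ x, (p + q : L2) x * w x = (∫ x, p x * w x) + ∫ x, q x * w x :=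
      fun p q w => by
        rw [← integral_add (integrable_mul_L2 p w) (integrable_mul_L2 q w)]
        refine integral_congr_ae ?_
        filter_upwards [Lp.coeFn_add p q] with x hx
        simp only [hx, Pi.add_apply, add_mul]
    have a' : ∫ x, V x * ((u₁ + u₂ : L2) x * v x)
        = (∫ x, V x * (u₁ x * v x)) + ∫ x, V x * (u₂ x * v x) := by
      rw [← integral_add
        (integrable_potential_mul (Lp.aestronglyMeasurable u₁) (Lp.aestronglyMeasurable v)
          m₁.2 hv.2)
        (integrable_potential_mul (Lp.aestronglyMeasurable u₂) (Lp.aestronglyMeasurable v)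
          m₂.2 hv.2)]
      refine integral_congr_ae ?_
      filter_upwards [Lp.coeFn_add u₁ u₂] with x hx
      simp only [hx, Pi.add_apply]
      ring
    have E₁ := e₁ v hv h hh
    have E₂ := e₂ v hv h hh
    simp only [Prod.mk_add_mk] at E₁ E₂ ⊢
    rw [a g₁ g₂ h, a f₁ f₂ v, a']
    linarith
  smul_mem' := by
    rintro c ⟨u, f⟩ ⟨m, g, d, e⟩
    refine ⟨(formDomain V).smul_mem c m, c • g, d.smul c, fun v hv h hh => ?_⟩
    have a : ∀ p w : L2, ∫ x, (c • p : L2) x * w x = c * ∫ x, p x * w x := fun p w => by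
      rw [← integral_const_mul]
      refine integral_congr_ae ?_
      filter_upwards [Lp.coeFn_smul c p] with x hx
      simp [hx, mul_assoc]
    have a' : ∫ x, V x * ((c • u : L2) x * v x) = c * ∫ x, V x * (u x * v x) := by
      rw [← integral_const_mul]
      refine integral_congr_ae ?_
      filter_upwards [Lp.coeFn_smul c u] with x hx
      simp only [hx, Pi.smul_apply, smul_eq_mul]
      ring
    have E := e v hv h hh
    simp only [Prod.smul_mk] at E ⊢
    rw [a g h, a f v, a', ← E]
    ring

/-- The eigenspace `{u ∈ D(H) | H u = μ u}` of `H = -d²/dx² + V`. -/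
def eigenspace (V : ℝ → ℝ) (μ : ℝ) : Submodule ℝ L2 :=
  (schrodingerGraph V).comap (LinearMap.prod LinearMap.id (μ • LinearMap.id))

/-- `lam 0 ≤ lam 1 ≤ ⋯ → ∞` is the sequence of all eigenvalues of `-d²/dx² + V` on `L²(ℝ)`, each
repeated according to its multiplicity. -/
structure IsEigenvalueSequence (V : ℝ → ℝ) (lam : ℕ → ℝ) : Prop where
  monotone : Monotone lam
  tendsto : Tendsto lam atTop atTop
  finiteDimensional : ∀ μ : ℝ, FiniteDimensional ℝ (eigenspace V μ)
  multiplicity : ∀ μ : ℝ, Module.finrank ℝ (eigenspace V μ) = {k : ℕ | lam k = μ}.ncard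

/-- The eigenvalues `2k + 1` of the unperturbed harmonic oscillator. -/
def lam0 (k : ℕ) : ℝ := 2 * (k : ℝ) + 1

def chi (n : ℕ) : ℝ :=
  if Odd n then
    (2 * (n : ℝ) + 3) / ((n : ℝ) + 1) * (Real.Gamma ((n : ℝ) / 2 + 1)
        / Real.Gamma (((n : ℝ) + 1) / 2))
      - ∑ k ∈ Finset.range (n + 1), 1 / √(lam0 k)
  else
    ((n : ℝ) + 1) * (Real.Gamma (((n : ℝ) + 1) / 2) / Real.Gamma ((n : ℝ) / 2 + 1))
      - ∑ k ∈ Finset.range (n + 1), 1 / √(lam0 k)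

def omega (n : ℕ) : ℝ := chi n + ∑ k ∈ Finset.range (n + 1), 1 / √(lam0 k)

def epsilon (n : ℕ) : ℝ :=
  omega n - √2 * (Real.Gamma ((n : ℝ) + 3 / 2) / Real.Gamma ((n : ℝ) + 1))

end PerturbedOscillator

end

/-! Two ingredients give the inequality. The first is the Ky Fan principle: the sum of the lowest `n
+ 1` eigenvalues is at most the sum of the form over any orthonormal system of `n + 1` elements of
the form domain. The Hermite functions `psi k` as trial functions turn this into `∑ lam k ≤ ∑ (lam0
k + ∫ q ψ_k²)` (`sum_eigenvalues_le`).

The second is the pointwise bound `∑_{k ≤ n} ψ_k² ≤ ω_n / π` (`sum_psi_sq_le_omega`). By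
Christoffel–Darboux, `2 ∑ ψ_k²` is a quadratic expression in `ψ_n` and `ψ_{n+1}`. Adding `ψ_{n+1}²`
yields a function with derivative `-2 x ψ_{n+1}²`, hence maximal at `0`, where its value is `2 ω_n /
π`. As `q` may change sign, the bound is integrated against `q + q_m e^{-x²} ≥ 0`. The Gaussian part
is then subtracted through its exact value `∑ ∫ e^{-x²} ψ_k² = √2 Γ(n+3/2) / (Γ(n+1) √π)`, and what
remains is `ε_n q_m / √π`. The weight `e^{-x²}` alone gives `ε_n ≥ 0`; log-convexity of `Γ` gives
the decay.

For the spectral theory, the form plus `q_m + 1` times the `L²` norm squared is the squared norm of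
a Hilbert space of triples `(u, u', s u)` with `s² = x² + q + q_m`. If `J` is its embedding into
`L²`, eigenvalues `μ` of the operator correspond to eigenvalues `1 / (μ + q_m + 1)` of `J J*`. Since
`s ≥ |x|`, comparison with the harmonic oscillator and completeness of the Hermite functions make
`J` compact (`formEmbedding_norm_sq_le`), so the spectral theorem for compact self-adjoint operators
applies. -/

noncomputable section

namespace PerturbedOscillator

open Polynomial

/-! ### Hermite polynomials: derivative, differential equation, recurrence. -/

/-- Physicists' Hermite polynomials. -/
def hermitePoly : ℕ → ℝ[X]
  | 0 => 1
  | n + 1 => 2 * X * hermitePoly n - derivative (hermitePoly n)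

lemma hermitePoly_succ (n : ℕ) :
    hermitePoly (n + 1) = 2 * X * hermitePoly n - derivative (hermitePoly n) := rfl

lemma derivative_hermitePoly_succ (n : ℕ) :
    derivative (hermitePoly (n + 1)) = 2 * ((n : ℝ[X]) + 1) * hermitePoly n := by
  induction n with
  | zero => simp [hermitePoly]
  | succ n ih =>
    rw [hermitePoly_succ (n + 1), derivative_sub, derivative_mul, ih]
    simp only [derivative_mul, derivative_ofNat, derivative_X, derivative_add, derivative_natCast,
      derivative_one, hermitePoly_succ n]
    push_cast
    ring

lemma derivative_hermitePoly (n : ℕ) :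
    derivative (hermitePoly n) = 2 * X * hermitePoly n - hermitePoly (n + 1) := by
  rw [hermitePoly_succ]; ring

lemma derivative_derivative_hermitePoly (n : ℕ) :
    derivative (derivative (hermitePoly n))
      = 2 * X * derivative (hermitePoly n) - 2 * (n : ℝ[X]) * hermitePoly n := by
  have h := derivative_hermitePoly_succ n
  rw [hermitePoly_succ, derivative_sub, derivative_mul] at h
  simp only [derivative_mul, derivative_ofNat, derivative_X] at h
  linear_combination -h

lemma X_mul_hermitePoly_succ (n : ℕ) :
    2 * (X * hermitePoly (n + 1)) = hermitePoly (n + 2) + 2 * ((n : ℝ[X]) + 1) * hermitePoly n := by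
  rw [← derivative_hermitePoly_succ, hermitePoly_succ (n + 1)]; ring

/-! ### Polynomials times a Gaussian -/

lemma integrable_eval_mul_exp {b : ℝ} (hb : 0 < b) (p : ℝ[X]) :
    Integrable (fun x : ℝ => p.eval x * Real.exp (-b * x ^ 2)) := by
  induction p using Polynomial.induction_on' with
  | add p r hp hr =>
    refine (hp.add hr).congr (Eventually.of_forall fun x => ?_)
    simp [add_mul]
  | monomial n a =>
    have h := integrable_rpow_mul_exp_neg_mul_sq hb (s := (n : ℝ)) (by
      have : (0 : ℝ) ≤ n := n.cast_nonneg
      linarith)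
    refine (h.const_mul a).congr (Eventually.of_forall fun x => ?_)
    simp [mul_assoc]

lemma hasDerivAt_eval_mul_exp (b : ℝ) (p : ℝ[X]) (x : ℝ) :
    HasDerivAt (fun x : ℝ => p.eval x * Real.exp (-b * x ^ 2))
      ((derivative p - 2 * C b * X * p).eval x * Real.exp (-b * x ^ 2)) x := by
  have h1 : HasDerivAt (fun x : ℝ => -b * x ^ 2) (-b * (2 * x)) x := by
    simpa using (hasDerivAt_pow 2 x).const_mul (-b)
  refine ((p.hasDerivAt x).mul h1.exp).congr_deriv ?_
  simp
  ring

/-- The source of the Hermite integrals below: each comes from a choice of `p` for which the total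
derivative is a combination of the wanted integrands. -/
lemma integral_derivative_mul_exp {b : ℝ} (hb : 0 < b) (p : ℝ[X]) :
    ∫ x : ℝ, (derivative p - 2 * C b * X * p).eval x * Real.exp (-b * x ^ 2) = 0 :=
  integral_eq_zero_of_hasDerivAt_of_integrable (hasDerivAt_eval_mul_exp b p)
    (integrable_eval_mul_exp hb _) (integrable_eval_mul_exp hb _)

/-- The function `p(x) exp(-x²/2)`. -/
def gaussPoly (p : ℝ[X]) (x : ℝ) : ℝ := p.eval x * Real.exp (-(1 / 2 : ℝ) * x ^ 2)

lemma gaussPoly_add (p r : ℝ[X]) (x : ℝ) :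
    gaussPoly (p + r) x = gaussPoly p x + gaussPoly r x := by simp [gaussPoly, add_mul]

lemma gaussPoly_C_mul (a : ℝ) (p : ℝ[X]) (x : ℝ) :
    gaussPoly (C a * p) x = a * gaussPoly p x := by simp [gaussPoly, mul_assoc]

lemma gaussPoly_X_mul (p : ℝ[X]) (x : ℝ) :
    gaussPoly (X * p) x = x * gaussPoly p x := by simp [gaussPoly, mul_assoc]

lemma hasDerivAt_gaussPoly (p : ℝ[X]) (x : ℝ) :
    HasDerivAt (gaussPoly p) (gaussPoly (derivative p - X * p) x) x := by
  refine (hasDerivAt_eval_mul_exp (1 / 2) p x).congr_deriv ?_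
  have : (2 * C (1 / 2) : ℝ[X]) = 1 := by
    rw [show (2 : ℝ[X]) = C 2 from rfl, ← C_mul]; norm_num
  rw [this, one_mul, gaussPoly]

lemma contDiff_gaussPoly (p : ℝ[X]) : ContDiff ℝ ∞ (gaussPoly p) := by
  unfold gaussPoly
  have h : ContDiff ℝ ∞ fun x : ℝ => p.eval x := by
    have := p.contDiff_aeval (𝕜 := ℝ) (R := ℝ) ∞
    simp only [coe_aeval_eq_eval] at this
    exact this
  exact h.mul (by fun_prop)

lemma continuous_gaussPoly (p : ℝ[X]) : Continuous (gaussPoly p) := (contDiff_gaussPoly p).continuous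

lemma gaussPoly_mul_gaussPoly (p r : ℝ[X]) (x : ℝ) :
    gaussPoly p x * gaussPoly r x = (p * r).eval x * Real.exp (-1 * x ^ 2) := by
  have : Real.exp (-1 * x ^ 2)
      = Real.exp (-(1 / 2 : ℝ) * x ^ 2) * Real.exp (-(1 / 2 : ℝ) * x ^ 2) := by
    rw [← Real.exp_add]; ring_nf
  rw [this, gaussPoly, gaussPoly, eval_mul]; ring

lemma integrable_gaussPoly_mul (p r : ℝ[X]) :
    Integrable (fun x => gaussPoly p x * gaussPoly r x) := by
  simp only [gaussPoly_mul_gaussPoly]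
  exact integrable_eval_mul_exp one_pos _

lemma memLp_gaussPoly (p : ℝ[X]) : MemLp (gaussPoly p) 2 volume := by
  rw [memLp_two_iff_integrable_sq (continuous_gaussPoly p).aestronglyMeasurable]
  simpa only [sq] using integrable_gaussPoly_mul p p

/-! ### Hermite functions -/

/-- The normalizing constant of the `n`-th Hermite function. -/
def hermiteConst (n : ℕ) : ℝ := 1 / √(2 ^ n * n.factorial * √Real.pi)

lemma hermiteConst_pos (n : ℕ) : 0 < hermiteConst n := by unfold hermiteConst; positivity

lemma hermiteConst_sq (n : ℕ) : hermiteConst n ^ 2 = 1 / (2 ^ n * n.factorial * √Real.pi) := by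
  unfold hermiteConst
  rw [div_pow, Real.sq_sqrt (by positivity), one_pow]

lemma hermiteConst_eq (n : ℕ) :
    hermiteConst n = √(2 * ((n : ℝ) + 1)) * hermiteConst (n + 1) := by
  unfold hermiteConst
  have : (2 : ℝ) ^ (n + 1) * (n + 1).factorial * √Real.pi
      = (2 * ((n : ℝ) + 1)) * (2 ^ n * n.factorial * √Real.pi) := by
    rw [Nat.factorial_succ]; push_cast; ring
  rw [this, Real.sqrt_mul (by positivity : (0 : ℝ) ≤ 2 * ((n : ℝ) + 1))]
  have h1 : √(2 * ((n : ℝ) + 1)) ≠ 0 := by positivity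
  rw [mul_one_div, div_mul_eq_div_div, div_self h1]

/-- The `n`-th Hermite function, normalized in `L²(ℝ)`. -/
def psi (n : ℕ) : ℝ → ℝ := gaussPoly (C (hermiteConst n) * hermitePoly n)

lemma psi_apply (n : ℕ) (x : ℝ) : psi n x = hermiteConst n * gaussPoly (hermitePoly n) x :=
  gaussPoly_C_mul _ _ _

/-- The coefficient `√(2(n+1))` in the ladder relations. -/
def ladder (n : ℕ) : ℝ := √(2 * ((n : ℝ) + 1))

lemma ladder_sq (n : ℕ) : ladder n ^ 2 = 2 * ((n : ℝ) + 1) := Real.sq_sqrt (by positivity)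

lemma ladder_pos (n : ℕ) : 0 < ladder n := by unfold ladder; positivity

lemma hasDerivAt_psi (n : ℕ) (x : ℝ) :
    HasDerivAt (psi n) (x * psi n x - ladder n * psi (n + 1) x) x := by
  have h := (hasDerivAt_gaussPoly (hermitePoly n) x).const_mul (hermiteConst n)
  have e : psi n = fun x => hermiteConst n * gaussPoly (hermitePoly n) x :=
    funext (psi_apply n)
  rw [e]
  refine h.congr_deriv ?_
  simp only [psi_apply, ladder]
  rw [← mul_assoc (√(2 * ((n : ℝ) + 1))), ← hermiteConst_eq, derivative_hermitePoly]
  simp [gaussPoly]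
  ring

lemma hasDerivAt_psi_succ (n : ℕ) (x : ℝ) :
    HasDerivAt (psi (n + 1)) (-x * psi (n + 1) x + ladder n * psi n x) x := by
  have h := (hasDerivAt_gaussPoly (hermitePoly (n + 1)) x).const_mul (hermiteConst (n + 1))
  have e : psi (n + 1) = fun x => hermiteConst (n + 1) * gaussPoly (hermitePoly (n + 1)) x :=
    funext (psi_apply (n + 1))
  rw [e]
  refine h.congr_deriv ?_
  simp only [psi_apply]
  rw [hermiteConst_eq n, derivative_hermitePoly_succ]
  have := ladder_sq n
  unfold ladder at *
  generalize √(2 * ((n : ℝ) + 1)) = a at this ⊢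
  simp [gaussPoly]
  linear_combination -(hermiteConst (n + 1) * eval x (hermitePoly n)
    * Real.exp (-(2⁻¹ * x ^ 2))) * this

lemma psi_recurrence (n : ℕ) (x : ℝ) :
    ladder (n + 1) * psi (n + 2) x = 2 * x * psi (n + 1) x - ladder n * psi n x := by
  have := (hasDerivAt_psi (n + 1) x).unique (hasDerivAt_psi_succ n x)
  linarith

/-- Wronskian argument: the derivative of `(H_n' H_m - H_n H_m') e^{-x²}` is `2 (m - n) H_m H_n
e^{-x²}`. -/
lemma integral_hermitePoly_mul_of_ne {m n : ℕ} (h : m ≠ n) :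
    ∫ x : ℝ, (hermitePoly m * hermitePoly n).eval x * Real.exp (-1 * x ^ 2) = 0 := by
  have := integral_derivative_mul_exp one_pos
    (derivative (hermitePoly n) * hermitePoly m - hermitePoly n * derivative (hermitePoly m))
  have e : derivative (derivative (hermitePoly n) * hermitePoly m
        - hermitePoly n * derivative (hermitePoly m))
      - 2 * C 1 * X * (derivative (hermitePoly n) * hermitePoly m
        - hermitePoly n * derivative (hermitePoly m))
      = C (2 * ((m : ℝ) - n)) * (hermitePoly m * hermitePoly n) := by
    simp only [derivative_sub, derivative_mul, derivative_derivative_hermitePoly]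
    simp
    rw [show (C 2 : ℝ[X]) = 2 from rfl]
    ring
  rw [e] at this
  simp only [eval_mul (p := C _), eval_C, mul_assoc] at this
  rw [integral_const_mul, integral_const_mul] at this
  have hmn : (m : ℝ) - n ≠ 0 := sub_ne_zero.mpr (by exact_mod_cast h)
  simpa [hmn] using this

/-- The derivative of `H_n H_{n+1} e^{-x²}` links the norms of `H_n` and `H_{n+1}`. -/
lemma integral_hermitePoly_sq (n : ℕ) :
    ∫ x : ℝ, (hermitePoly n * hermitePoly n).eval x * Real.exp (-1 * x ^ 2)
      = 2 ^ n * n.factorial * √Real.pi := by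
  induction n with
  | zero => simpa [hermitePoly] using integral_gaussian 1
  | succ n ih =>
    have := integral_derivative_mul_exp one_pos (hermitePoly n * hermitePoly (n + 1))
    have e : derivative (hermitePoly n * hermitePoly (n + 1))
        - 2 * C 1 * X * (hermitePoly n * hermitePoly (n + 1))
        = C (2 * ((n : ℝ) + 1)) * (hermitePoly n * hermitePoly n)
          - hermitePoly (n + 1) * hermitePoly (n + 1) := by
      rw [derivative_mul, derivative_hermitePoly_succ, derivative_hermitePoly]
      simp
      rw [show (C 2 : ℝ[X]) = 2 from rfl]
      ring
    rw [e] at this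
    simp only [eval_sub, eval_mul (p := C _), eval_C, sub_mul, mul_assoc (2 * ((n : ℝ) + 1))] at this
    rw [integral_sub ((integrable_eval_mul_exp one_pos _).const_mul _)
      (integrable_eval_mul_exp one_pos _), integral_const_mul, ih] at this
    rw [Nat.factorial_succ]
    push_cast
    linear_combination -this

lemma integral_psi_mul_psi (m n : ℕ) :
    ∫ x, psi m x * psi n x = if m = n then 1 else 0 := by
  have e : ∀ x, psi m x * psi n x = (hermiteConst m * hermiteConst n) *
      ((hermitePoly m * hermitePoly n).eval x * Real.exp (-1 * x ^ 2)) := fun x => by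
    rw [psi_apply, psi_apply, ← gaussPoly_mul_gaussPoly]; ring
  simp only [e]
  rw [integral_const_mul]
  split_ifs with h
  · subst h
    rw [integral_hermitePoly_sq, ← sq, hermiteConst_sq]
    field_simp
  · rw [integral_hermitePoly_mul_of_ne h, mul_zero]

lemma integral_hermitePoly_sq_mul_exp_two (n : ℕ) :
    ∫ x : ℝ, (hermitePoly n * hermitePoly n).eval x * Real.exp (-2 * x ^ 2)
      = 2 ^ n * Real.Gamma (n + 1 / 2) / √2 := by
  induction n with
  | zero =>
    have := integral_gaussian 2
    simp only [hermitePoly, mul_one, eval_one, one_mul, pow_zero, Nat.cast_zero, zero_add]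
    rw [this, Real.Gamma_one_half_eq, Real.sqrt_div Real.pi_pos.le]
  | succ n ih =>
    have h1 := integral_derivative_mul_exp two_pos (hermitePoly n * hermitePoly (n + 1))
    have h2 := integral_derivative_mul_exp two_pos (X * hermitePoly n * hermitePoly n)
    -- For the weight `e^{-2x²}` each of the two total derivatives contains `-2 X H_n H_{n+1}`;
    -- their difference removes it and leaves a recursion between the squares.
    have e : derivative (hermitePoly n * hermitePoly (n + 1))
        - 2 * C 2 * X * (hermitePoly n * hermitePoly (n + 1))
        - (derivative (X * hermitePoly n * hermitePoly n)
          - 2 * C 2 * X * (X * hermitePoly n * hermitePoly n))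
        = C (2 * (n : ℝ) + 1) * (hermitePoly n * hermitePoly n)
          - hermitePoly (n + 1) * hermitePoly (n + 1) := by
      rw [derivative_mul, derivative_mul, derivative_mul, derivative_hermitePoly_succ,
        derivative_hermitePoly]
      simp
      rw [show (C 2 : ℝ[X]) = 2 from rfl]
      ring
    have h3 : ∫ x : ℝ, ((C (2 * (n : ℝ) + 1) * (hermitePoly n * hermitePoly n)
          - hermitePoly (n + 1) * hermitePoly (n + 1)).eval x * Real.exp (-2 * x ^ 2)) = 0 := by
      rw [← e]
      simp only [eval_sub (p := derivative _ - _) (q := derivative _ - _), sub_mul (eval _ _)]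
      rw [integral_sub (integrable_eval_mul_exp two_pos _) (integrable_eval_mul_exp two_pos _),
        h1, h2, sub_zero]
    simp only [eval_sub, eval_mul (p := C _), eval_C, sub_mul, mul_assoc (2 * (n : ℝ) + 1)] at h3
    rw [integral_sub ((integrable_eval_mul_exp two_pos _).const_mul _)
      (integrable_eval_mul_exp two_pos _), integral_const_mul, ih] at h3
    have hg : Real.Gamma (((n + 1 : ℕ) : ℝ) + 1 / 2)
        = ((n : ℝ) + 1 / 2) * Real.Gamma (n + 1 / 2) := by
      rw [← Real.Gamma_add_one (by positivity)]; push_cast; ring_nf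
    rw [hg]
    linear_combination -h3

lemma integral_exp_mul_psi_sq (n : ℕ) :
    ∫ x, Real.exp (-x ^ 2) * psi n x ^ 2
      = Real.Gamma (n + 1 / 2) / (n.factorial * √2 * √Real.pi) := by
  have e : ∀ x, Real.exp (-x ^ 2) * psi n x ^ 2 = hermiteConst n ^ 2 *
      ((hermitePoly n * hermitePoly n).eval x * Real.exp (-2 * x ^ 2)) := fun x => by
    have : Real.exp (-2 * x ^ 2) = Real.exp (-x ^ 2) * Real.exp (-1 * x ^ 2) := by
      rw [← Real.exp_add]; ring_nf
    rw [psi_apply, mul_pow, sq (gaussPoly _ _), gaussPoly_mul_gaussPoly, this]; ring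
  simp only [e]
  rw [integral_const_mul, integral_hermitePoly_sq_mul_exp_two, hermiteConst_sq]
  field_simp

/-- Christoffel–Darboux on the diagonal: the right side is `ladder n * (ψ_{n+1}' ψ_n - ψ_{n+1}
ψ_n')` after the ladder relations. It is checked by induction with the three-term recurrence. -/
lemma sum_psi_sq_eq (n : ℕ) (x : ℝ) :
    2 * ∑ k ∈ Finset.range (n + 1), psi k x ^ 2
      = ladder n ^ 2 * (psi n x ^ 2 + psi (n + 1) x ^ 2)
        - 2 * ladder n * x * (psi n x * psi (n + 1) x) := by
  induction n with
  | zero =>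
    -- `psi_recurrence` starts with `psi 2`, so this relation is read off from two expressions for
    -- the derivative of `psi 0`.
    have h : ladder 0 * psi 1 x = 2 * x * psi 0 x := by
      have h := (hasDerivAt_psi 0 x).unique
        ((hasDerivAt_gaussPoly _ x) : HasDerivAt (psi 0) _ x)
      simp only [hermitePoly, mul_one, derivative_C, zero_sub] at h
      have e : gaussPoly (-(X * C (hermiteConst 0))) x = -(x * psi 0 x) := by
        simp [psi, gaussPoly, hermitePoly]; ring
      rw [e] at h
      linarith
    have h2 := ladder_sq 0
    simp only [zero_add, Finset.range_one, Finset.sum_singleton, Nat.cast_zero, mul_one] at *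
    linear_combination (-psi 0 x ^ 2) * h2 - (ladder 0 * psi 1 x) * h
  | succ n ih =>
    rw [Finset.sum_range_succ, mul_add, ih]
    have h := psi_recurrence n x
    have h1 := ladder_sq n
    have h2 := ladder_sq (n + 1)
    push_cast at h2
    linear_combination (psi (n + 1) x ^ 2) * (h1 - h2)
      - (ladder (n + 1) * psi (n + 2) x - ladder n * psi n x) * h

/-- The Sonin-type majorant of `2 ∑ ψ_k²`. -/
def majorant (n : ℕ) (x : ℝ) : ℝ :=
  ladder n ^ 2 * (psi n x ^ 2 + psi (n + 1) x ^ 2)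
    - 2 * ladder n * x * (psi n x * psi (n + 1) x) + psi (n + 1) x ^ 2

/-- The Christoffel–Darboux part has derivative `-2 a ψ_n ψ_{n+1}` with `a = ladder n`. The extra
term `ψ_{n+1}²` has derivative `-2 x ψ_{n+1}² + 2 a ψ_n ψ_{n+1}`, so the indefinite cross terms
cancel. -/
lemma hasDerivAt_majorant (n : ℕ) (x : ℝ) :
    HasDerivAt (majorant n) (-2 * x * psi (n + 1) x ^ 2) x := by
  have hu := hasDerivAt_psi n x
  have hv := hasDerivAt_psi_succ n x
  have := (((((hu.pow 2).add (hv.pow 2)).const_mul (ladder n ^ 2)).sub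
    (((hasDerivAt_id x).const_mul (2 * ladder n)).mul (hu.mul hv))).add (hv.pow 2))
  refine this.congr_deriv ?_
  simp
  ring

lemma majorant_le (n : ℕ) (x : ℝ) : majorant n x ≤ majorant n 0 := by
  have hd : Differentiable ℝ (majorant n) := fun y => (hasDerivAt_majorant n y).differentiableAt
  rcases le_total 0 x with hx | hx
  · have : AntitoneOn (majorant n) (Set.Ici 0) := by
      refine antitoneOn_of_deriv_nonpos (convex_Ici 0) hd.continuous.continuousOn
        hd.differentiableOn fun y hy => ?_
      rw [interior_Ici, Set.mem_Ioi] at hy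
      rw [(hasDerivAt_majorant n y).deriv]
      nlinarith [mul_nonneg hy.le (sq_nonneg (psi (n + 1) y))]
    exact this Set.self_mem_Ici hx hx
  · have : MonotoneOn (majorant n) (Set.Iic 0) := by
      refine monotoneOn_of_deriv_nonneg (convex_Iic 0) hd.continuous.continuousOn
        hd.differentiableOn fun y hy => ?_
      rw [interior_Iic, Set.mem_Iio] at hy
      rw [(hasDerivAt_majorant n y).deriv]
      nlinarith [mul_nonneg (neg_nonneg.2 hy.le) (sq_nonneg (psi (n + 1) y))]
    exact this hx Set.self_mem_Iic hx

lemma sum_psi_sq_le (n : ℕ) (x : ℝ) :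
    ∑ k ∈ Finset.range (n + 1), psi k x ^ 2 ≤ majorant n 0 / 2 := by
  have h1 := sum_psi_sq_eq n x
  have h2 := majorant_le n x
  unfold majorant at h2 ⊢
  nlinarith [sq_nonneg (psi (n + 1) x)]

lemma psi_odd_zero (m : ℕ) : psi (2 * m + 1) 0 = 0 := by
  induction m with
  | zero => simp [psi_apply, gaussPoly, hermitePoly]
  | succ m ih =>
    have h := psi_recurrence (2 * m + 1) 0
    rw [ih] at h
    have := (ladder_pos (2 * m + 1 + 1)).ne'
    simpa [this, mul_add] using h

/-- At `x = 0` the recurrence skips one index, so squares at consecutive even indices have ratio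
`(2m + 1) / (2m + 2)`, which a quotient of Gamma values reproduces. -/
lemma psi_even_zero_sq (m : ℕ) :
    psi (2 * m) 0 ^ 2 = Real.Gamma (m + 1 / 2) / (Real.pi * Real.Gamma (m + 1)) := by
  induction m with
  | zero =>
    simp only [mul_zero, psi_apply, gaussPoly, hermitePoly, mul_pow, hermiteConst_sq]
    rw [show ((0 : ℕ) : ℝ) + 1 / 2 = 1 / 2 by simp, Real.Gamma_one_half_eq]
    simp
    have : √Real.pi ^ 2 = Real.pi := Real.sq_sqrt Real.pi_pos.le
    have h0 : √Real.pi ≠ 0 := by positivity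
    field_simp
    rw [this]
  | succ m ih =>
    have h := psi_recurrence (2 * m) 0
    have h1 := ladder_sq (2 * m)
    have h2 := ladder_sq (2 * m + 1)
    have h3 : ladder (2 * m + 1) ^ 2 * psi (2 * (m + 1)) 0 ^ 2
        = ladder (2 * m) ^ 2 * psi (2 * m) 0 ^ 2 := by
      rw [← mul_pow, ← mul_pow, show 2 * (m + 1) = 2 * m + 2 by ring, h]; ring
    rw [h1, h2, ih] at h3
    have hg1 : Real.Gamma (((m + 1 : ℕ) : ℝ) + 1 / 2)
        = ((m : ℝ) + 1 / 2) * Real.Gamma (m + 1 / 2) := by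
      rw [← Real.Gamma_add_one (by positivity)]; push_cast; ring_nf
    have hg2 : Real.Gamma (((m + 1 : ℕ) : ℝ) + 1) = ((m : ℝ) + 1) * Real.Gamma (m + 1) := by
      rw [← Real.Gamma_add_one (by positivity)]; push_cast; ring_nf
    have hG : Real.Gamma ((m : ℝ) + 1) ≠ 0 := (Real.Gamma_pos_of_pos (by positivity)).ne'
    rw [hg1, hg2]
    push_cast at h3 ⊢
    have hm : (m : ℝ) + 1 ≠ 0 := by positivity
    have hpi := Real.pi_ne_zero
    field_simp at h3 ⊢
    linear_combination h3

/-! ### Completeness -/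

lemma integrable_L2_mul_gaussPoly (f : L2) (p : ℝ[X]) :
    Integrable (fun x => f x * gaussPoly p x) :=
  (Lp.memLp f).integrable_mul (q := 2) (memLp_gaussPoly p)

lemma integral_mul_gaussPoly_eq_zero {f : L2} (hf : ∀ n, ∫ x, f x * psi n x = 0) (p : ℝ[X]) :
    ∫ x, f x * gaussPoly p x = 0 := by
  have h_add : ∀ p r : ℝ[X], ∫ x, f x * gaussPoly (p + r) x
      = (∫ x, f x * gaussPoly p x) + ∫ x, f x * gaussPoly r x := fun p r => by
    rw [← integral_add (integrable_L2_mul_gaussPoly f p) (integrable_L2_mul_gaussPoly f r)]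
    simp only [gaussPoly_add, mul_add]
  have h_smul : ∀ (a : ℝ) (p : ℝ[X]), ∫ x, f x * gaussPoly (C a * p) x
      = a * ∫ x, f x * gaussPoly p x := fun a p => by
    rw [← integral_const_mul]
    simp only [gaussPoly_C_mul, mul_left_comm]
  -- The induction on `k` needs all `n` at once: one factor `X` turns `H_{n+1}` into a combination
  -- of `H_{n+2}` and `H_n`.
  have key : ∀ k n : ℕ, ∫ x, f x * gaussPoly (X ^ k * hermitePoly n) x = 0 := by
    intro k
    induction k with
    | zero =>
      intro n
      have := hf n
      rw [psi, h_smul] at this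
      simpa [(hermiteConst_pos n).ne'] using this
    | succ k ih =>
      intro n
      cases n with
      | zero =>
        have e : X ^ (k + 1) * hermitePoly 0 = C (1 / 2) * (X ^ k * hermitePoly 1) := by
          have : (C (1 / 2) * 2 : ℝ[X]) = 1 := by
            rw [show (2 : ℝ[X]) = C 2 from rfl, ← C_mul]; norm_num
          simp only [hermitePoly, mul_one, derivative_one, sub_zero]
          linear_combination (-X ^ (k + 1)) * this
        rw [e, h_smul, ih, mul_zero]
      | succ n =>
        have e : X ^ (k + 1) * hermitePoly (n + 1) = C (1 / 2) * (X ^ k * hermitePoly (n + 2))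
            + C ((n : ℝ) + 1) * (X ^ k * hermitePoly n) := by
          have : (C (1 / 2) * 2 : ℝ[X]) = 1 := by
            rw [show (2 : ℝ[X]) = C 2 from rfl, ← C_mul]; norm_num
          have h := X_mul_hermitePoly_succ n
          simp only [C_add, C_1, map_natCast]
          linear_combination (C (1 / 2) * X ^ k) * h
            + (((n : ℝ[X]) + 1) * X ^ k * hermitePoly n
              - X ^ k * X * hermitePoly (n + 1)) * this
        rw [e, h_add, h_smul, h_smul, ih, ih, mul_zero, mul_zero, add_zero]
  induction p using Polynomial.induction_on' with
  | add p r hp hr => rw [h_add, hp, hr, add_zero]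
  | monomial n a =>
    rw [← C_mul_X_pow_eq_monomial, h_smul]
    have := key n 0
    rw [hermitePoly, mul_one] at this
    rw [this, mul_zero]

/-- An integrable function whose Fourier integrals all vanish is zero almost everywhere. -/
lemma ae_eq_zero_of_integral_mul_cexp {g : ℝ → ℝ} (hg : Integrable g)
    (h : ∀ t : ℝ, ∫ x, (g x : ℂ) * Complex.exp (t * x * Complex.I) = 0) : g =ᵐ[volume] 0 := by
  have hp := hg.pos_part
  have hn := hg.neg_part
  -- The positive and negative parts of `g` are densities of finite measures with the same
  -- characteristic function, hence of the same measure.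
  set μ := volume.withDensity (fun x => ENNReal.ofReal (max (g x) 0))
  set ν := volume.withDensity (fun x => ENNReal.ofReal (max (-g x) 0))
  have hμ : IsFiniteMeasure μ := isFiniteMeasure_withDensity_ofReal hp.2
  have hν : IsFiniteMeasure ν := isFiniteMeasure_withDensity_ofReal hn.2
  have hexp : ∀ t : ℝ, Continuous fun x : ℝ => Complex.exp (t * x * Complex.I) := fun t => by
    fun_prop
  have hb : ∀ t x : ℝ, ‖Complex.exp (t * x * Complex.I)‖ ≤ 1 := fun t x => by
    rw [← Complex.ofReal_mul, Complex.norm_exp_ofReal_mul_I]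
  have key : ∀ f : ℝ → ℝ, Integrable f → (∀ x, 0 ≤ f x) → ∀ t : ℝ,
      charFun (volume.withDensity (fun x => ENNReal.ofReal (f x))) t
        = ∫ x, (f x : ℂ) * Complex.exp (t * x * Complex.I) := by
    intro f hf hf0 t
    rw [charFun_apply_real, integral_withDensity_eq_integral_toReal_smul₀
      hf.aestronglyMeasurable.aemeasurable.ennreal_ofReal (by simp)]
    refine integral_congr_ae (Eventually.of_forall fun x => ?_)
    simp [ENNReal.toReal_ofReal (hf0 x)]
  have hμν : μ = ν := by
    refine Measure.ext_of_charFun (funext fun t => ?_)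
    rw [key _ hp (fun x => le_max_right _ _), key _ hn (fun x => le_max_right _ _),
      ← sub_eq_zero, ← integral_sub, ← h t]
    · refine integral_congr_ae (Eventually.of_forall fun x => ?_)
      simp only
      rw [← sub_mul, ← Complex.ofReal_sub, max_zero_sub_max_neg_zero_eq_self]
    · exact hp.ofReal.mul_bdd (c := 1) (hexp t).aestronglyMeasurable (Eventually.of_forall (hb t))
    · exact hn.ofReal.mul_bdd (c := 1) (hexp t).aestronglyMeasurable (Eventually.of_forall (hb t))
  have hae := (withDensity_eq_iff hp.aestronglyMeasurable.aemeasurable.ennreal_ofReal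
    hn.aestronglyMeasurable.aemeasurable.ennreal_ofReal
    (by
      have := hμ.measure_univ_lt_top
      rw [withDensity_apply _ MeasurableSet.univ, setLIntegral_univ] at this
      exact this.ne)).1 hμν
  filter_upwards [hae] with x hx
  rw [ENNReal.ofReal_eq_ofReal_iff (le_max_right _ _) (le_max_right _ _)] at hx
  simp only [Pi.zero_apply]
  rcases le_total 0 (g x) with h0 | h0
  · rw [max_eq_left h0, max_eq_right (by linarith)] at hx; exact hx
  · rw [max_eq_right h0, max_eq_left (by linarith)] at hx; linarith

/-- Supplies the dominating function for integrating the exponential series term by term. -/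
lemma integrable_L2_mul_gauss_mul_exp (f : L2) (t : ℝ) :
    Integrable (fun x => |f x * gaussPoly 1 x| * Real.exp |t * x|) := by
  have hc : Continuous fun x : ℝ => gaussPoly 1 x * Real.exp |t * x| :=
    (continuous_gaussPoly 1).mul (by fun_prop)
  have hm : MemLp (fun x : ℝ => gaussPoly 1 x * Real.exp |t * x|) 2 volume := by
    rw [memLp_two_iff_integrable_sq hc.aestronglyMeasurable]
    have hi : Integrable (fun x : ℝ => Real.exp (2 * t ^ 2) * Real.exp (-(1 / 2 : ℝ) * x ^ 2)) :=
      (integrable_exp_neg_mul_sq (by norm_num)).const_mul _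
    refine hi.mono' (hc.pow 2).aestronglyMeasurable (Eventually.of_forall fun x => ?_)
    rw [Real.norm_of_nonneg (sq_nonneg _)]
    simp only [gaussPoly, eval_one, one_mul]
    rw [← Real.exp_add, ← Real.exp_add, ← Real.exp_nat_mul, Real.exp_le_exp]
    have h1 : |t * x| = |t| * |x| := abs_mul t x
    push_cast
    -- The exponents satisfy `2|t||x| - x² ≤ 2t² - x²/2`, the gap being `(2|t| - |x|)² / 2`.
    nlinarith [sq_nonneg (2 * |t| - |x|), sq_abs t, sq_abs x]
  have := ((Lp.memLp f).integrable_mul (q := 2) hm).norm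
  refine this.congr (Eventually.of_forall fun x => ?_)
  simp only [Pi.mul_apply, Real.norm_eq_abs, abs_mul, Real.abs_exp, mul_assoc]

/-- The Hermite functions are complete in `L²(ℝ)`. -/
lemma eq_zero_of_integral_mul_psi_eq_zero {f : L2} (hf : ∀ n, ∫ x, f x * psi n x = 0) :
    f = 0 := by
  set g : ℝ → ℝ := fun x => f x * gaussPoly 1 x
  have hg : Integrable g := integrable_L2_mul_gaussPoly f 1
  have hmom : ∀ k : ℕ, ∫ x, g x * x ^ k = 0 := fun k => by
    rw [← integral_mul_gaussPoly_eq_zero hf (X ^ k)]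
    refine integral_congr_ae (Eventually.of_forall fun x => ?_)
    simp [g, gaussPoly]
    ring
  -- All moments of `g` vanish, so expanding `e^{itx}` in powers of `x` shows that its Fourier
  -- integrals vanish too.
  have hzero := ae_eq_zero_of_integral_mul_cexp hg fun t => by
    have hs : HasSum (fun k : ℕ => ∫ x, (g x : ℂ) * ((t * x * Complex.I) ^ k / k.factorial))
        (∫ x, (g x : ℂ) * Complex.exp (t * x * Complex.I)) := by
      refine hasSum_integral_of_dominated_convergence
        (fun k x => |g x| * (|t * x| ^ k / k.factorial)) (fun k => ?_) (fun k => ?_) ?_ ?_ ?_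
      · refine hg.ofReal.aestronglyMeasurable.mul (Continuous.aestronglyMeasurable ?_)
        fun_prop
      · refine Eventually.of_forall fun x => ?_
        simp [abs_mul]
      · refine Eventually.of_forall fun x => ?_
        exact (Real.summable_pow_div_factorial _).mul_left _
      · refine (integrable_L2_mul_gauss_mul_exp f t).congr (Eventually.of_forall fun x => ?_)
        simp only
        rw [tsum_mul_left, Real.exp_eq_exp_ℝ, NormedSpace.exp_eq_tsum_div]
      · refine Eventually.of_forall fun x => ?_
        have := NormedSpace.expSeries_div_hasSum_exp ((t : ℂ) * x * Complex.I)
        rw [← Complex.exp_eq_exp_ℂ] at this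
        exact this.mul_left _
    have hz : ∀ k : ℕ, ∫ x, (g x : ℂ) * ((t * x * Complex.I) ^ k / k.factorial) = 0 := fun k => by
      have e : ∀ x : ℝ, (g x : ℂ) * ((t * x * Complex.I) ^ k / k.factorial)
          = ((t * Complex.I) ^ k / k.factorial) * ((g x * x ^ k : ℝ) : ℂ) := fun x => by
        push_cast
        ring
      simp only [e]
      rw [integral_const_mul, integral_complex_ofReal, hmom]
      simp
    simp only [hz] at hs
    exact hs.unique hasSum_zero
  refine (Lp.eq_zero_iff_ae_eq_zero).2 ?_
  filter_upwards [hzero] with x hx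
  simpa [g, gaussPoly] using hx

/-! ### Gamma function estimates -/

/-- `∫ ∑_{k ≤ n} e^{-x²} ψ_k²` in closed form. -/
lemma sum_integral_exp_mul_psi_sq (n : ℕ) :
    ∑ k ∈ Finset.range (n + 1), ∫ x, Real.exp (-x ^ 2) * psi k x ^ 2
      = √2 * (Real.Gamma (n + 3 / 2) / Real.Gamma (n + 1)) / √Real.pi := by
  have h2 : √2 ^ 2 = (2 : ℝ) := Real.sq_sqrt (by norm_num)
  have h20 : √2 ≠ (0 : ℝ) := by positivity
  have hpi : √Real.pi ≠ 0 := by positivity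
  induction n with
  | zero =>
    simp only [zero_add, Finset.range_one, Finset.sum_singleton, integral_exp_mul_psi_sq]
    have hg : Real.Gamma (((0 : ℕ) : ℝ) + 3 / 2)
        = (1 / 2) * Real.Gamma (((0 : ℕ) : ℝ) + 1 / 2) := by
      rw [show ((0 : ℕ) : ℝ) + 3 / 2 = (1 / 2 : ℝ) + 1 by norm_num, Real.Gamma_add_one (by norm_num)]
      norm_num
    rw [hg]
    simp
    field_simp
    linear_combination -h2
  | succ n ih =>
    rw [Finset.sum_range_succ, ih, integral_exp_mul_psi_sq]
    have hg : Real.Gamma (((n + 1 : ℕ) : ℝ) + 3 / 2)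
        = ((n : ℝ) + 3 / 2) * Real.Gamma (n + 3 / 2) := by
      rw [← Real.Gamma_add_one (by positivity)]; push_cast; ring_nf
    have hg2 : Real.Gamma (((n + 1 : ℕ) : ℝ) + 1) = ((n : ℝ) + 1) * n.factorial := by
      rw [Real.Gamma_nat_eq_factorial, Nat.factorial_succ]; push_cast; ring
    have hg3 : ((n + 1 : ℕ) : ℝ) + 1 / 2 = n + 3 / 2 := by push_cast; ring
    have hf : (n.factorial : ℝ) ≠ 0 := by positivity
    rw [hg, hg2, hg3, Real.Gamma_nat_eq_factorial, Nat.factorial_succ]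
    push_cast
    field_simp
    linear_combination (((n : ℝ) + 1) * 2 - (2 * n + 3)) * h2

lemma omega_of_odd {n : ℕ} (h : Odd n) :
    omega n = (2 * (n : ℝ) + 3) / ((n : ℝ) + 1) * (Real.Gamma ((n : ℝ) / 2 + 1)
        / Real.Gamma (((n : ℝ) + 1) / 2)) := by
  simp [omega, chi, h]

lemma omega_of_not_odd {n : ℕ} (h : ¬Odd n) :
    omega n = ((n : ℝ) + 1) * (Real.Gamma (((n : ℝ) + 1) / 2) / Real.Gamma ((n : ℝ) / 2 + 1)) := by
  simp [omega, chi, h]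

/-- The parity split in `chi` originates here: at `0` only the even one of `ψ_n`, `ψ_{n+1}`
survives, with coefficient `2(n+1)` for `n` even and `2(n+1) + 1 = 2n + 3` for `n` odd. -/
lemma majorant_zero (n : ℕ) : majorant n 0 / 2 = omega n / Real.pi := by
  have hl := ladder_sq n
  have hpi := Real.pi_ne_zero
  rcases Nat.even_or_odd' n with ⟨m, rfl | rfl⟩
  · rw [omega_of_not_odd (by simp), majorant, psi_odd_zero, psi_even_zero_sq, hl]
    push_cast
    have e1 : (2 * (m : ℝ) + 1) / 2 = m + 1 / 2 := by ring
    have e2 : 2 * (m : ℝ) / 2 + 1 = m + 1 := by ring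
    rw [e1, e2]
    have hG : Real.Gamma ((m : ℝ) + 1) ≠ 0 := (Real.Gamma_pos_of_pos (by positivity)).ne'
    field_simp
    ring
  · rw [omega_of_odd ⟨m, rfl⟩, majorant, psi_odd_zero, show 2 * m + 1 + 1 = 2 * (m + 1) by ring,
      psi_even_zero_sq, hl]
    push_cast
    have e1 : (2 * (m : ℝ) + 1 + 1) / 2 = m + 1 := by ring
    have e2 : (2 * (m : ℝ) + 1) / 2 + 1 = m + 1 + 1 / 2 := by ring
    have e3 : Real.Gamma ((m : ℝ) + 1 + 1) = ((m : ℝ) + 1) * Real.Gamma (m + 1) :=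
      Real.Gamma_add_one (by positivity)
    rw [e1, e2, e3]
    have hG : Real.Gamma ((m : ℝ) + 1) ≠ 0 := (Real.Gamma_pos_of_pos (by positivity)).ne'
    field_simp
    ring

lemma sum_psi_sq_le_omega (n : ℕ) (x : ℝ) :
    ∑ k ∈ Finset.range (n + 1), psi k x ^ 2 ≤ omega n / Real.pi :=
  (sum_psi_sq_le n x).trans_eq (majorant_zero n)

lemma integrable_psi_sq (n : ℕ) : Integrable fun x => psi n x ^ 2 := by
  simpa only [sq, psi] using integrable_gaussPoly_mul _ _

lemma continuous_psi (n : ℕ) : Continuous (psi n) := continuous_gaussPoly _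

lemma integrable_exp_mul_psi_sq (n : ℕ) :
    Integrable fun x => Real.exp (-x ^ 2) * psi n x ^ 2 := by
  refine (integrable_psi_sq n).bdd_mul (c := 1) (by fun_prop) (Eventually.of_forall fun x => ?_)
  rw [Real.norm_of_nonneg (Real.exp_pos _).le, Real.exp_le_one_iff]
  nlinarith [sq_nonneg x]

lemma integrable_exp_neg_sq : Integrable fun x : ℝ => Real.exp (-x ^ 2) := by
  simpa using integrable_exp_neg_mul_sq (one_pos : (0 : ℝ) < 1)

lemma integral_exp_neg_sq : ∫ x : ℝ, Real.exp (-x ^ 2) = √Real.pi := by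
  simpa using integral_gaussian 1

/-- The pointwise bound integrated against `e^{-x²}`: the left side is known exactly, the right side
is `ω_n / √π`. -/
lemma epsilon_nonneg (n : ℕ) : 0 ≤ epsilon n := by
  have h1 : ∑ k ∈ Finset.range (n + 1), ∫ x, Real.exp (-x ^ 2) * psi k x ^ 2
      ≤ omega n / Real.pi * √Real.pi := by
    rw [← integral_finsetSum _ fun k _ => integrable_exp_mul_psi_sq k, ← integral_exp_neg_sq,
      ← integral_const_mul]
    refine integral_mono (integrable_finsetSum _ fun k _ => integrable_exp_mul_psi_sq k)
      (integrable_exp_neg_sq.const_mul _) fun x => ?_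
    simp only
    rw [← Finset.mul_sum, mul_comm]
    exact mul_le_mul_of_nonneg_right (sum_psi_sq_le_omega n x) (Real.exp_pos _).le
  rw [sum_integral_exp_mul_psi_sq, div_le_iff₀ (by positivity), mul_assoc,
    Real.mul_self_sqrt Real.pi_pos.le, div_mul_cancel₀ _ Real.pi_ne_zero] at h1
  exact sub_nonneg.2 h1

/-- `Γ(x + 1/2) ≤ √x Γ(x)`, by log-convexity. -/
lemma Gamma_add_half_le {x : ℝ} (hx : 0 < x) :
    Real.Gamma (x + 1 / 2) ≤ √x * Real.Gamma x := by
  have h := Real.Gamma_mul_add_mul_le_rpow_Gamma_mul_rpow_Gamma hx (by linarith : 0 < x + 1)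
    (a := 1 / 2) (b := 1 / 2) (by norm_num) (by norm_num) (by norm_num)
  have hG := Real.Gamma_pos_of_pos hx
  rw [Real.Gamma_add_one hx.ne', ← Real.sqrt_eq_rpow, ← Real.sqrt_eq_rpow,
    ← Real.sqrt_mul hG.le] at h
  have e : Real.Gamma x * (x * Real.Gamma x) = x * Real.Gamma x ^ 2 := by ring
  rw [e, Real.sqrt_mul hx.le, Real.sqrt_sq hG.le] at h
  convert h using 2
  ring

lemma le_Gamma_add_half {x : ℝ} (hx : 0 < x) :
    x * Real.Gamma x ≤ √(x + 1 / 2) * Real.Gamma (x + 1 / 2) := by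
  have h := Gamma_add_half_le (by linarith : 0 < x + 1 / 2)
  rw [← Real.Gamma_add_one hx.ne']
  convert h using 2
  ring

/-- The shift `3` is a convenient common choice: the even case would allow `2`, while the odd case
reduces to `(2n+3)² ≤ 4(n+1)(n+3)`. -/
lemma omega_le (n : ℕ) : omega n ≤ √2 * √((n : ℝ) + 3) := by
  by_cases h : Odd n
  · rw [omega_of_odd h]
    have h1 := Gamma_add_half_le (by positivity : 0 < ((n : ℝ) + 1) / 2)
    have hG := Real.Gamma_pos_of_pos (by positivity : 0 < ((n : ℝ) + 1) / 2)
    rw [show ((n : ℝ) + 1) / 2 + 1 / 2 = n / 2 + 1 by ring, ← div_le_iff₀ hG] at h1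
    refine (mul_le_mul_of_nonneg_left h1 (by positivity)).trans ?_
    rw [← Real.sqrt_mul (by norm_num)]
    refine Real.le_sqrt_of_sq_le ?_
    rw [mul_pow, Real.sq_sqrt (by positivity), div_pow, div_mul_div_comm, div_le_iff₀ (by positivity)]
    have : (0 : ℝ) ≤ n := n.cast_nonneg
    have hn : (1 : ℝ) ≤ n := by exact_mod_cast h.pos
    nlinarith [mul_nonneg this this, mul_nonneg this (mul_nonneg this this)]
  · rw [omega_of_not_odd h]
    have h1 := le_Gamma_add_half (by positivity : 0 < ((n : ℝ) + 1) / 2)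
    have hG := Real.Gamma_pos_of_pos (by positivity : 0 < (n : ℝ) / 2 + 1)
    rw [show ((n : ℝ) + 1) / 2 + 1 / 2 = n / 2 + 1 by ring, ← div_le_iff₀ hG] at h1
    have h2 : √2 * √((n : ℝ) + 2) = 2 * √((n : ℝ) / 2 + 1) := by
      rw [show (n : ℝ) + 2 = 2 * (n / 2 + 1) by ring, Real.sqrt_mul (by norm_num), ← mul_assoc,
        Real.mul_self_sqrt (by norm_num)]
    refine le_trans ?_ (mul_le_mul_of_nonneg_left (Real.sqrt_le_sqrt (by linarith :
      (n : ℝ) + 2 ≤ n + 3)) (Real.sqrt_nonneg 2))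
    rw [h2]
    calc _ = 2 * (((n : ℝ) + 1) / 2 * Real.Gamma (((n : ℝ) + 1) / 2)
          / Real.Gamma ((n : ℝ) / 2 + 1)) := by ring
      _ ≤ _ := by linarith

/-- Both terms of `epsilon n` are compared with the same root; the leading parts cancel because
`√(n+3) - (n+1)/√(n+3) = 2/√(n+3)`. -/
lemma epsilon_le (n : ℕ) : epsilon n ≤ 2 * √2 * (1 / √((n : ℝ) + 3)) := by
  have h1 := le_Gamma_add_half (by positivity : 0 < (n : ℝ) + 1)
  have hG := Real.Gamma_pos_of_pos (by positivity : 0 < (n : ℝ) + 1)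
  rw [show (n : ℝ) + 1 + 1 / 2 = n + 3 / 2 by ring] at h1
  have hs : √((n : ℝ) + 3 / 2) ≤ √((n : ℝ) + 3) := Real.sqrt_le_sqrt (by linarith)
  have hG2 := Real.Gamma_pos_of_pos (by positivity : 0 < (n : ℝ) + 3 / 2)
  have h2 : ((n : ℝ) + 1) / √((n : ℝ) + 3)
      ≤ Real.Gamma ((n : ℝ) + 3 / 2) / Real.Gamma ((n : ℝ) + 1) := by
    rw [div_le_div_iff₀ (by positivity) hG, mul_comm (Real.Gamma _) (√_)]
    exact h1.trans (mul_le_mul_of_nonneg_right hs hG2.le)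
  have h3 : √((n : ℝ) + 3) - ((n : ℝ) + 1) / √((n : ℝ) + 3) = 2 * (1 / √((n : ℝ) + 3)) := by
    have : √((n : ℝ) + 3) ≠ 0 := by positivity
    field_simp
    rw [Real.sq_sqrt (by positivity)]
    ring
  have h4 := omega_le n
  have h5 : (0 : ℝ) ≤ √2 * (1 / √((n : ℝ) + 3)) := by positivity
  have h6 := mul_le_mul_of_nonneg_left h2 (Real.sqrt_nonneg 2)
  unfold epsilon
  have h7 : √2 * (√((n : ℝ) + 3) - ((n : ℝ) + 1) / √((n : ℝ) + 3)) = √2 * (2 * (1 / √((n : ℝ) + 3))) := by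
    rw [h3]
  linarith

lemma epsilon_isBigO : (fun n : ℕ => epsilon n) =O[atTop] fun n : ℕ => 1 / √(n : ℝ) := by
  refine IsBigO.of_bound (2 * √2) ?_
  filter_upwards [eventually_gt_atTop 0] with n hn
  have hn' : (0 : ℝ) < n := by exact_mod_cast hn
  rw [Real.norm_of_nonneg (epsilon_nonneg n), Real.norm_of_nonneg (by positivity)]
  refine (epsilon_le n).trans (mul_le_mul_of_nonneg_left ?_ (by positivity))
  exact one_div_le_one_div_of_le (by positivity) (Real.sqrt_le_sqrt (by linarith))

/-! ### Eigenvectors of a form given by an embedding of Hilbert spaces, and Ky Fan's principle. -/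

section Abstract

variable {K H : Type*} [NormedAddCommGroup K] [InnerProductSpace ℝ K]
  [NormedAddCommGroup H] [InnerProductSpace ℝ H]

/-- The eigenspace at `Λ` of the operator on `H` associated with the inner product of `K`,
regarded as a quadratic form on `H` through the embedding `J`. -/
def formEigenspace (J : K →L[ℝ] H) (Λ : ℝ) : Submodule ℝ H where
  carrier := {x | ∃ k, J k = x ∧ ∀ k', inner ℝ k k' = Λ * inner ℝ x (J k')}
  zero_mem' := ⟨0, by simp, by simp⟩
  add_mem' := by
    rintro x y ⟨k, hk, hk'⟩ ⟨l, hl, hl'⟩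
    refine ⟨k + l, by simp [hk, hl], fun m => ?_⟩
    rw [inner_add_left, inner_add_left, hk', hl', mul_add]
  smul_mem' := by
    rintro c x ⟨k, hk, hk'⟩
    refine ⟨c • k, by simp [hk], fun m => ?_⟩
    rw [real_inner_smul_left, real_inner_smul_left, hk']
    ring

lemma pos_of_mem_formEigenspace {J : K →L[ℝ] H} {Λ : ℝ} {x : H} (hx : x ∈ formEigenspace J Λ)
    (h0 : x ≠ 0) : 0 < Λ := by
  obtain ⟨k, rfl, hk⟩ := hx
  have h := hk k
  rw [real_inner_self_eq_norm_sq, real_inner_self_eq_norm_sq] at h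
  have hk0 : k ≠ 0 := by rintro rfl; simp at h0
  have h1 : 0 < ‖k‖ ^ 2 := by positivity
  have h2 : 0 < ‖J k‖ ^ 2 := by positivity
  rw [h] at h1
  exact pos_of_mul_pos_left h1 h2.le

lemma inner_eq_zero_of_mem_formEigenspace {J : K →L[ℝ] H} {Λ M : ℝ} {x y : H}
    (hx : x ∈ formEigenspace J Λ) (hy : y ∈ formEigenspace J M) (h : Λ ≠ M) :
    inner ℝ x y = 0 := by
  obtain ⟨k, rfl, hk⟩ := hx
  obtain ⟨l, rfl, hl⟩ := hy
  have h1 := hk l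
  rw [real_inner_comm, hl, real_inner_comm] at h1
  have : (M - Λ) * inner ℝ (J k) (J l) = 0 := by linarith
  exact (mul_eq_zero.1 this).resolve_left (sub_ne_zero.2 h.symm)

/-- Bessel's inequality in `K`: the lifts `k i` of the `w i` are orthogonal there with `‖k i‖² = Λ
i`, and `⟨k i, p⟩ = Λ i ⟨w i, J p⟩`. -/
lemma sum_mul_inner_sq_le {ι : Type*} {J : K →L[ℝ] H} {w : ι → H} (hw : Orthonormal ℝ w)
    {Λ : ι → ℝ} (h : ∀ i, w i ∈ formEigenspace J (Λ i)) (s : Finset ι) (p : K) :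
    ∑ i ∈ s, Λ i * inner ℝ (w i) (J p) ^ 2 ≤ ‖p‖ ^ 2 := by
  classical
  choose k hk hk' using h
  have h1 : inner ℝ (∑ i ∈ s, inner ℝ (w i) (J p) • k i) p
      = ∑ i ∈ s, Λ i * inner ℝ (w i) (J p) ^ 2 := by
    rw [sum_inner]
    refine Finset.sum_congr rfl fun i _ => ?_
    rw [real_inner_smul_left, hk']
    ring
  have h2 : ‖∑ i ∈ s, inner ℝ (w i) (J p) • k i‖ ^ 2
      = ∑ i ∈ s, Λ i * inner ℝ (w i) (J p) ^ 2 := by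
    rw [← real_inner_self_eq_norm_sq, sum_inner]
    refine Finset.sum_congr rfl fun i hi => ?_
    rw [real_inner_smul_left, hk', map_sum, inner_sum, Finset.sum_eq_single i]
    · rw [map_smul, hk, real_inner_smul_right, real_inner_self_eq_norm_sq, hw.1 i]
      ring
    · intro j _ hj
      rw [map_smul, hk, real_inner_smul_right, hw.2 hj.symm, mul_zero]
    · exact fun h => absurd hi h
  have h3 := norm_sub_sq_real p (∑ i ∈ s, inner ℝ (w i) (J p) • k i)
  rw [real_inner_comm, h1, h2] at h3
  nlinarith [sq_nonneg ‖p - ∑ i ∈ s, inner ℝ (w i) (J p) • k i‖]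

lemma hasSum_inner_sq [CompleteSpace H] {w : ℕ → H} (hw : Orthonormal ℝ w)
    (hc : (Submodule.span ℝ (Set.range w))ᗮ = ⊥) (x : H) :
    HasSum (fun i => inner ℝ (w i) x ^ 2) (‖x‖ ^ 2) := by
  have := (HilbertBasis.mkOfOrthogonalEqBot hw hc).hasSum_inner_mul_inner x x
  rw [real_inner_self_eq_norm_sq] at this
  refine this.congr_fun ?_
  intro i
  simp [real_inner_comm, sq]

/-- The quantitative compactness estimate provided by a complete system of eigenvectors. -/
lemma norm_sq_le_of_complete [CompleteSpace H] {J : K →L[ℝ] H} {w : ℕ → H}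
    (hw : Orthonormal ℝ w) (hc : (Submodule.span ℝ (Set.range w))ᗮ = ⊥) {Λ : ℕ → ℝ}
    (hΛ : Monotone Λ) (h0 : ∀ i, 0 < Λ i) (h : ∀ i, w i ∈ formEigenspace J (Λ i)) (N : ℕ) (p : K) :
    ‖J p‖ ^ 2 ≤ ∑ i ∈ Finset.range N, inner ℝ (w i) (J p) ^ 2 + ‖p‖ ^ 2 / Λ N := by
  refine le_of_tendsto (hasSum_inner_sq hw hc (J p)).tendsto_sum_nat ?_
  filter_upwards [eventually_ge_atTop N] with M hM
  rw [← Finset.sum_range_add_sum_Ico _ hM]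
  refine add_le_add_right ?_ _
  -- On the tail `Λ N ≤ Λ i`, so the tail times `Λ N` is controlled by the Bessel inequality of the
  -- form.
  rw [le_div_iff₀ (h0 N), Finset.sum_mul]
  refine le_trans ?_ (sum_mul_inner_sq_le hw h (Finset.Ico N M) p)
  refine Finset.sum_le_sum fun i hi => ?_
  rw [mul_comm]
  exact mul_le_mul_of_nonneg_right (hΛ (Finset.mem_Ico.1 hi).1) (sq_nonneg _)

/-- The Ky Fan variational principle for sums of eigenvalues. -/
lemma sum_le_sum_norm_sq [CompleteSpace H] {J : K →L[ℝ] H} {w : ℕ → H}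
    (hw : Orthonormal ℝ w) (hc : (Submodule.span ℝ (Set.range w))ᗮ = ⊥) {Λ : ℕ → ℝ}
    (hΛ : Monotone Λ) (h : ∀ i, w i ∈ formEigenspace J (Λ i)) {p : ℕ → K}
    (hp : Orthonormal ℝ fun i => J (p i)) (n : ℕ) :
    ∑ j ∈ Finset.range (n + 1), Λ j ≤ ∑ i ∈ Finset.range (n + 1), ‖p i‖ ^ 2 := by
  -- These weights lie in `[0, 1]` by Bessel and have total `n + 1` by Parseval, so `∑ Λ j * a j`
  -- cannot be smaller than with all the weight on the first `n + 1` indices.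
  set a : ℕ → ℝ := fun j => ∑ i ∈ Finset.range (n + 1), inner ℝ (w j) (J (p i)) ^ 2 with ha
  have ha1 : ∀ j, a j ≤ 1 := fun j => by
    have := hp.sum_inner_products_le (w j) (s := Finset.range (n + 1))
    simpa [ha, real_inner_comm, hw.1 j] using this
  have ha0 : ∀ j, 0 ≤ a j := fun j => Finset.sum_nonneg fun i _ => sq_nonneg _
  have hsum : HasSum a (n + 1 : ℕ) := by
    have := hasSum_sum (s := Finset.range (n + 1)) fun i _ => hasSum_inner_sq hw hc (J (p i))
    simpa [hp.1] using this
  -- Partial sums reach the total weight only in the limit; the missing weight is charged at the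
  -- rate `Λ n`.
  have hlim : Tendsto (fun M => ∑ j ∈ Finset.range (n + 1), Λ j
      + Λ n * (∑ j ∈ Finset.range M, a j - (n + 1 : ℕ))) atTop
      (𝓝 (∑ j ∈ Finset.range (n + 1), Λ j)) := by
    have := (((hsum.tendsto_sum_nat).sub_const ((n + 1 : ℕ) : ℝ)).const_mul (Λ n)).const_add
      (∑ j ∈ Finset.range (n + 1), Λ j)
    simpa using this
  refine le_of_tendsto hlim ?_
  filter_upwards [eventually_ge_atTop (n + 1)] with M hM
  have h1 : ∑ j ∈ Finset.range M, Λ j * a j ≤ ∑ i ∈ Finset.range (n + 1), ‖p i‖ ^ 2 := by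
    simp only [ha, Finset.mul_sum]
    rw [Finset.sum_comm]
    exact Finset.sum_le_sum fun i _ => sum_mul_inner_sq_le hw h _ _
  refine le_trans ?_ h1
  rw [← Finset.sum_range_add_sum_Ico _ hM, ← Finset.sum_range_add_sum_Ico (fun j => Λ j * a j) hM]
  -- Termwise this is `(Λ n - Λ j) (1 - a j) ≥ 0`.
  have h2 : ∑ j ∈ Finset.range (n + 1), (Λ j + Λ n * (a j - 1))
      ≤ ∑ j ∈ Finset.range (n + 1), Λ j * a j := by
    refine Finset.sum_le_sum fun j hj => ?_
    have h3 : Λ j ≤ Λ n := hΛ (Nat.lt_succ_iff.1 (Finset.mem_range.1 hj))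
    nlinarith [mul_nonneg (sub_nonneg.2 h3) (sub_nonneg.2 (ha1 j))]
  have h3 : ∑ j ∈ Finset.Ico (n + 1) M, Λ n * a j ≤ ∑ j ∈ Finset.Ico (n + 1) M, Λ j * a j := by
    refine Finset.sum_le_sum fun j hj => ?_
    exact mul_le_mul_of_nonneg_right (hΛ ((Nat.le_succ n).trans (Finset.mem_Ico.1 hj).1)) (ha0 j)
  rw [Finset.sum_add_distrib, ← Finset.mul_sum, Finset.sum_sub_distrib] at h2
  rw [← Finset.mul_sum] at h3
  simp only [Finset.sum_const, Finset.card_range, nsmul_eq_mul, mul_one] at h2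
  linarith

lemma norm_sub_sum_sq {b : ℕ → H} (hb : Orthonormal ℝ b) (N : ℕ) (x : H) :
    ‖x - ∑ i ∈ Finset.range N, inner ℝ (b i) x • b i‖ ^ 2
      = ‖x‖ ^ 2 - ∑ i ∈ Finset.range N, inner ℝ (b i) x ^ 2 := by
  have h1 : inner ℝ x (∑ i ∈ Finset.range N, inner ℝ (b i) x • b i)
      = ∑ i ∈ Finset.range N, inner ℝ (b i) x ^ 2 := by
    rw [inner_sum]
    refine Finset.sum_congr rfl fun i _ => ?_
    rw [real_inner_smul_right, real_inner_comm, sq]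
  have h2 : ‖∑ i ∈ Finset.range N, inner ℝ (b i) x • b i‖ ^ 2
      = ∑ i ∈ Finset.range N, inner ℝ (b i) x ^ 2 := by
    rw [← real_inner_self_eq_norm_sq, hb.inner_sum]
    simp [sq]
  rw [norm_sub_sq_real, h1, h2]
  ring

/-- `J` is the norm limit of its compositions with the projections onto the first `N` vectors of
`b`; the error is at most `√(1 / (2N + 2))`. -/
lemma isCompactOperator_of_norm_sq_le [CompleteSpace H] {J : K →L[ℝ] H} {b : ℕ → H}
    (hb : Orthonormal ℝ b) (hJ : ∀ (N : ℕ) (k : K), ‖J k‖ ^ 2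
      ≤ ∑ i ∈ Finset.range N, inner ℝ (b i) (J k) ^ 2 + ‖k‖ ^ 2 / (2 * (N : ℝ) + 2)) :
    IsCompactOperator J := by
  set F : ℕ → K →L[ℝ] H := fun N =>
    ∑ i ∈ Finset.range N, ((innerSL ℝ (b i)).smulRight (b i)).comp J with hF
  have hFapp : ∀ N k, F N k = ∑ i ∈ Finset.range N, inner ℝ (b i) (J k) • b i := fun N k => by
    simp [hF]
  have hFc : ∀ N, IsCompactOperator (F N) := fun N => by
    induction N with
    | zero => simpa [hF] using isCompactOperator_zero
    | succ N ih =>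
      have e : F (N + 1) = F N + ((innerSL ℝ (b N)).smulRight (b N)).comp J := by
        simp [hF, Finset.sum_range_succ]
      rw [e]
      refine ih.add ?_
      have h1 : IsCompactOperator ((innerSL ℝ (b N)).comp J) :=
        isCompactOperator_of_locallyCompactSpace_dom _
      exact h1.clm_comp ((ContinuousLinearMap.id ℝ ℝ).smulRight (b N))
  have hlim : Tendsto F atTop (𝓝 J) := by
    rw [tendsto_iff_norm_sub_tendsto_zero]
    have h0 : Tendsto (fun N : ℕ => √(1 / (2 * (N : ℝ) + 2))) atTop (𝓝 0) := by
      have h1 : Tendsto (fun N : ℕ => 1 / (2 * (N : ℝ) + 2)) atTop (𝓝 0) := by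
        simp only [one_div]
        refine tendsto_inv_atTop_zero.comp ?_
        exact tendsto_atTop_add_const_right _ _
          (tendsto_natCast_atTop_atTop.const_mul_atTop two_pos)
      simpa using h1.sqrt
    refine squeeze_zero (fun _ => norm_nonneg _) (fun N => ?_) h0
    refine ContinuousLinearMap.opNorm_le_bound _ (Real.sqrt_nonneg _) fun k => ?_
    refine le_of_sq_le_sq ?_ (by positivity)
    rw [mul_pow, Real.sq_sqrt (by positivity), sub_apply, norm_sub_rev, hFapp,
      norm_sub_sum_sq hb]
    have := hJ N k
    rw [one_div_mul_eq_div]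
    linarith
  exact isCompactOperator_of_tendsto hlim (Eventually.of_forall hFc)

variable [CompleteSpace K] [CompleteSpace H]

open ContinuousLinearMap in
-- The weak equation says exactly that the lift of `x` is `Λ J* x`; applying `J` gives `x = Λ J J*
-- x`.
lemma mem_formEigenspace_iff {J : K →L[ℝ] H} {Λ : ℝ} (hΛ : 0 < Λ) {x : H} :
    x ∈ formEigenspace J Λ ↔
      x ∈ Module.End.eigenspace ((J ∘L adjoint J : H →L[ℝ] H) : H →ₗ[ℝ] H) Λ⁻¹ := by
  rw [Module.End.mem_eigenspace_iff]
  simp only [ContinuousLinearMap.coe_coe, ContinuousLinearMap.comp_apply]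
  constructor
  · rintro ⟨k, rfl, hk⟩
    have : k = Λ • adjoint J (J k) := ext_inner_right ℝ fun v => by
      rw [hk, real_inner_smul_left, adjoint_inner_left]
    have h2 : adjoint J (J k) = Λ⁻¹ • k := by
      nth_rewrite 2 [this]
      rw [smul_smul, inv_mul_cancel₀ hΛ.ne', one_smul]
    rw [h2, map_smul]
  · intro h
    refine ⟨Λ • adjoint J x, ?_, fun k' => ?_⟩
    · rw [map_smul, h, smul_smul, mul_inv_cancel₀ hΛ.ne', one_smul]
    · rw [real_inner_smul_left, adjoint_inner_left]

lemma isCompactOperator_comp_adjoint {J : K →L[ℝ] H} (hJ : IsCompactOperator J) :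
    IsCompactOperator (J ∘L ContinuousLinearMap.adjoint J : H →L[ℝ] H) :=
  hJ.comp_clm _

lemma finiteDimensional_formEigenspace {J : K →L[ℝ] H} (hJ : IsCompactOperator J) (Λ : ℝ) :
    FiniteDimensional ℝ (formEigenspace J Λ) := by
  rcases le_or_gt Λ 0 with h | h
  · have : formEigenspace J Λ = ⊥ := (Submodule.eq_bot_iff _).2 fun x hx => by
      by_contra h0
      exact absurd (pos_of_mem_formEigenspace hx h0) (not_lt.2 h)
    rw [this]
    infer_instance
  · have : formEigenspace J Λ = Module.End.eigenspace
        ((J ∘L ContinuousLinearMap.adjoint J : H →L[ℝ] H) : H →ₗ[ℝ] H) Λ⁻¹ :=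
      Submodule.ext fun x => mem_formEigenspace_iff h
    rw [this]
    exact ContinuousLinearMap.finite_dimensional_eigenspace (isCompactOperator_comp_adjoint hJ) _
      (inv_ne_zero h.ne')

open ContinuousLinearMap in
-- Spectral theorem for the compact symmetric operator `J J*`. Density of the range of `J` makes
-- `J*` injective, so only positive eigenvalues occur and each is the inverse of a form eigenvalue.
lemma iSup_formEigenspace_orthogonal {J : K →L[ℝ] H} (hJ : IsCompactOperator J)
    (hd : ∀ x, (∀ k, inner ℝ x (J k) = 0) → x = 0) : (⨆ Λ, formEigenspace J Λ)ᗮ = ⊥ := by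
  set T : H →L[ℝ] H := J ∘L adjoint J with hT
  have hTin : ∀ x y, inner ℝ (T x) y = inner ℝ (adjoint J x) (adjoint J y) := fun x y => by
    rw [adjoint_inner_right]; rfl
  have hsymm : T.IsSymmetric := fun x y => by
    change inner ℝ (T x) y = inner ℝ x (T y)
    rw [hTin, real_inner_comm (T y) x, hTin, real_inner_comm]
  have h := orthogonalComplement_iSup_eigenspaces_eq_bot (isCompactOperator_comp_adjoint hJ) hsymm
  rw [eq_bot_iff, ← h]
  refine Submodule.orthogonal_le (iSup_le fun μ x hx => ?_)
  by_cases h0 : x = 0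
  · rw [h0]; exact Submodule.zero_mem _
  have hx' : T x = μ • x := Module.End.mem_eigenspace_iff.1 hx
  have hJx : adjoint J x ≠ 0 := fun h => h0 (hd x fun k => by
    rw [← adjoint_inner_left, h, inner_zero_left])
  have h1 := hTin x x
  rw [hx', real_inner_smul_left, real_inner_self_eq_norm_sq, real_inner_self_eq_norm_sq] at h1
  have h2 : 0 < ‖adjoint J x‖ ^ 2 := by positivity
  have hμ : 0 < μ := by
    rw [← h1] at h2
    exact pos_of_mul_pos_left h2 (sq_nonneg _)
  refine Submodule.mem_iSup_of_mem μ⁻¹ ((mem_formEigenspace_iff (inv_pos.2 hμ)).2 ?_)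
  rwa [inv_inv]

end Abstract

/-! ### Enumerating eigenvalues with multiplicity. -/

/-- An infinite linear order with finite sublevel sets of a monotone function is a copy of `ℕ`. -/
lemma exists_orderIso_nat {ι : Type*} [LinearOrder ι] [Infinite ι] {f : ι → ℝ} (hf : Monotone f)
    (hfin : ∀ L, {i | f i ≤ L}.Finite) : Nonempty (ι ≃o ℕ) := by
  have hIic : ∀ i : ι, (Set.Iic i).Finite := fun i => (hfin (f i)).subset fun j hj => hf hj
  have : LocallyFiniteOrder ι := LocallyFiniteOrder.ofFiniteIcc fun a b =>
    (hIic b).subset fun x hx => hx.2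
  have : NoMaxOrder ι := ⟨fun a => by
    by_contra! h
    exact Set.infinite_univ ((hIic a).subset fun x _ => h x)⟩
  obtain ⟨i₀⟩ : Nonempty ι := inferInstance
  -- By linearity, a minimum of the finite set `Iic i₀` is a global minimum.
  obtain ⟨m, hm, hmin⟩ := Set.exists_min_image (Set.Iic i₀) id (hIic i₀) ⟨i₀, le_refl i₀⟩
  let : OrderBot ι :=
    { bot := m
      bot_le := fun x => (le_total x i₀).elim (fun h => hmin x h) fun h => le_trans hm h }
  let : SuccOrder ι := LinearLocallyFiniteOrder.succOrder ι
  let : PredOrder ι := LinearLocallyFiniteOrder.predOrder ι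
  exact ⟨orderIsoNatOfLinearSuccPredArch⟩

section Abstract

variable {H : Type*} [NormedAddCommGroup H] [InnerProductSpace ℝ H] (E : ℝ → Submodule ℝ H)

/-- `lam` enumerates the real numbers `μ` with multiplicities `dim (E μ)`, in nondecreasing
order. -/
structure IsEnumeration (lam : ℕ → ℝ) : Prop where
  monotone : Monotone lam
  tendsto : Tendsto lam atTop atTop
  multiplicity : ∀ μ : ℝ, Module.finrank ℝ (E μ) = {k : ℕ | lam k = μ}.ncard

/-- The index set of an orthonormal system adapted to the family `E`. -/
abbrev EigenIndex : Type := Σₗ μ : ℝ, Fin (Module.finrank ℝ (E μ))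

/-- Attaches eigenvectors to an arbitrary enumeration. Divergence of `lam` makes its fibres finite,
so that equal cardinalities yield bijections. -/
lemma IsEnumeration.exists_equiv {E : ℝ → Submodule ℝ H} {lam : ℕ → ℝ} (h : IsEnumeration E lam) :
    ∃ e : ℕ ≃ EigenIndex E, ∀ k, (e k).1 = lam k := by
  have hfin : ∀ μ, Finite {k : ℕ // lam k = μ} := fun μ => by
    obtain ⟨N, hN⟩ := eventually_atTop.1 (h.tendsto.eventually_gt_atTop μ)
    refine Set.Finite.to_subtype ((Set.finite_lt_nat N).subset fun k hk => ?_)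
    by_contra hk'
    exact absurd hk (hN k (not_lt.1 hk')).ne'
  have hcard : ∀ μ, Nat.card {k : ℕ // lam k = μ} = Module.finrank ℝ (E μ) := fun μ =>
    (h.multiplicity μ).symm
  let e₁ : (Σ μ, {k : ℕ // lam k = μ}) ≃ EigenIndex E :=
    Equiv.sigmaCongrRight fun μ => Finite.equivFinOfCardEq (hcard μ)
  exact ⟨(Equiv.sigmaFiberEquiv lam).symm.trans e₁, fun k => rfl⟩

/-- The lexicographic order on `EigenIndex E` lists the values in nondecreasing order; finite
sublevel sets make it a copy of `ℕ`. -/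
lemma exists_isEnumeration {E : ℝ → Submodule ℝ H} [Infinite (EigenIndex E)]
    (hfin : ∀ L, {i : EigenIndex E | i.1 ≤ L}.Finite) : ∃ lam, IsEnumeration E lam := by
  have hmono : Monotone fun i : EigenIndex E => i.1 := fun i j hij => by
    rcases Sigma.Lex.le_def.1 hij with h | ⟨h, _⟩
    · exact h.le
    · exact h.le
  obtain ⟨e⟩ := exists_orderIso_nat hmono hfin
  refine ⟨fun k => (e.symm k).1, hmono.comp e.symm.monotone, ?_, fun μ => ?_⟩
  · refine tendsto_atTop.2 fun L => ?_
    have h : {k : ℕ | (e.symm k).1 ≤ L}.Finite := (hfin L).preimage e.symm.injective.injOn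
    rw [← Nat.cofinite_eq_atTop]
    filter_upwards [h.compl_mem_cofinite] with k hk
    exact (not_le.1 (show ¬(e.symm k).1 ≤ L from hk)).le
  · set g : Fin (Module.finrank ℝ (E μ)) → EigenIndex E := fun j => ⟨μ, j⟩ with hg
    have hginj : Function.Injective g := fun a b h => by cases h; rfl
    have h1 : {k : ℕ | (e.symm k).1 = μ} = e.symm ⁻¹' {i : EigenIndex E | i.1 = μ} := rfl
    have h2 : {i : EigenIndex E | i.1 = μ}
        = Set.range g := by
      ext ⟨ν, j⟩
      constructor
      · rintro rfl
        exact ⟨j, rfl⟩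
      · rintro ⟨j', h⟩
        exact (congrArg Sigma.fst h).symm
    rw [h1, Set.ncard_preimage_of_injective_subset_range e.symm.injective
      (by rw [e.symm.surjective.range_eq]; exact Set.subset_univ _), h2,
      ← Set.image_univ, Set.ncard_image_of_injective _ hginj, Set.ncard_univ,
      Nat.card_eq_fintype_card, Fintype.card_fin]

variable [∀ μ, FiniteDimensional ℝ (E μ)]

/-- An orthonormal system adapted to the family `E`. -/
def eigenSystem (i : EigenIndex E) : H := stdOrthonormalBasis ℝ (E i.1) i.2

lemma eigenSystem_mem (i : EigenIndex E) : eigenSystem E i ∈ E i.1 := Subtype.coe_prop _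

variable {E}

lemma orthonormal_eigenSystem
    (hE : ∀ μ ν, μ ≠ ν → ∀ x ∈ E μ, ∀ y ∈ E ν, inner ℝ x y = 0) :
    Orthonormal ℝ (eigenSystem E) := by
  constructor
  · rintro ⟨μ, i⟩
    exact (stdOrthonormalBasis ℝ (E μ)).orthonormal.1 i
  · rintro ⟨μ, i⟩ ⟨ν, j⟩ hij
    by_cases h : μ = ν
    · subst h
      have : i ≠ j := fun h => hij (by rw [h])
      exact (stdOrthonormalBasis ℝ (E μ)).orthonormal.2 this
    · exact hE μ ν h _ (eigenSystem_mem E ⟨μ, i⟩) _ (eigenSystem_mem E ⟨ν, j⟩)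

lemma span_eigenSystem_orthogonal (hE : (⨆ μ, E μ)ᗮ = ⊥) :
    (Submodule.span ℝ (Set.range (eigenSystem E)))ᗮ = ⊥ := by
  rw [eq_bot_iff, ← hE]
  refine Submodule.orthogonal_le (iSup_le fun μ x hx => ?_)
  have h := (stdOrthonormalBasis ℝ (E μ)).sum_repr ⟨x, hx⟩
  have h2 : x = ∑ i, (stdOrthonormalBasis ℝ (E μ)).repr ⟨x, hx⟩ i • eigenSystem E ⟨μ, i⟩ := by
    have := congrArg (Submodule.subtype (E μ)) h
    rw [map_sum] at this
    exact this.symm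
  rw [h2]
  exact Submodule.sum_mem _ fun i _ => Submodule.smul_mem _ _ (Submodule.subset_span ⟨_, rfl⟩)

end Abstract

/-! ### Discreteness of the spectrum and the variational bound for enumerations. -/

section Compact

variable {K H : Type*} [NormedAddCommGroup K] [InnerProductSpace ℝ K]
  [NormedAddCommGroup H] [InnerProductSpace ℝ H]

/-- Dimension count: for `N ≥ L`, an eigenvector with eigenvalue at most `L` has at least half of
its squared norm in the span of the first `N` vectors of `b`. By Bessel these shares add up to at
most `N`, so `2N + 1` such eigenvectors are too many. -/
lemma finite_setOf_le_of_norm_sq_le {J : K →L[ℝ] H} {b : ℕ → H}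
    (hb : Orthonormal ℝ b) (hJ : ∀ (N : ℕ) (k : K), ‖J k‖ ^ 2
      ≤ ∑ i ∈ Finset.range N, inner ℝ (b i) (J k) ^ 2 + ‖k‖ ^ 2 / (2 * (N : ℝ) + 2))
    {ι : Type*} {w : ι → H} (hw : Orthonormal ℝ w) {Λ : ι → ℝ}
    (h : ∀ i, w i ∈ formEigenspace J (Λ i)) (L : ℝ) : {i | Λ i ≤ L}.Finite := by
  obtain ⟨N, hN⟩ := exists_nat_ge L
  by_contra hinf
  obtain ⟨s, hs, hcard⟩ := Set.Infinite.exists_subset_card_eq hinf (2 * N + 1)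
  have h1 : ∀ i ∈ s, (1 / 2 : ℝ) ≤ ∑ j ∈ Finset.range N, inner ℝ (b j) (w i) ^ 2 := fun i hi => by
    have hiL : Λ i ≤ L := hs hi
    obtain ⟨k, hk, hk'⟩ := h i
    have h2 := hJ N k
    have h3 := hk' k
    rw [hk, real_inner_self_eq_norm_sq, real_inner_self_eq_norm_sq, hw.1 i] at h3
    rw [hk, hw.1 i, h3] at h2
    have h4 : Λ i * 1 ^ 2 / (2 * (N : ℝ) + 2) ≤ 1 / 2 := by
      rw [div_le_div_iff₀ (by positivity) two_pos]
      linarith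
    linarith
  have h2 : ∑ i ∈ s, ∑ j ∈ Finset.range N, inner ℝ (b j) (w i) ^ 2 ≤ N := by
    rw [Finset.sum_comm]
    calc _ ≤ ∑ j ∈ Finset.range N, (1 : ℝ) := Finset.sum_le_sum fun j _ => by
          have := hw.sum_inner_products_le (b j) (s := s)
          simpa [real_inner_comm, hb.1 j] using this
      _ = N := by simp
  have h3 := Finset.sum_le_sum h1
  rw [Finset.sum_const, hcard, nsmul_eq_mul] at h3
  push_cast at h3
  linarith

variable {J : K →L[ℝ] H} {c : ℝ}

lemma formEigenspace_shift_orthogonal (J : K →L[ℝ] H) (c μ ν : ℝ) (hμν : μ ≠ ν) :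
    ∀ x ∈ formEigenspace J (μ + c), ∀ y ∈ formEigenspace J (ν + c), inner ℝ x y = 0 :=
  fun _ hx _ hy => inner_eq_zero_of_mem_formEigenspace hx hy (by simpa using hμν)

variable [CompleteSpace K] [CompleteSpace H]

lemma iSup_formEigenspace_shift_orthogonal (hJ : IsCompactOperator J)
    (hd : ∀ x, (∀ k, inner ℝ x (J k) = 0) → x = 0) :
    (⨆ μ, formEigenspace J (μ + c))ᗮ = ⊥ := by
  rw [← iSup_formEigenspace_orthogonal hJ hd]
  congr 1
  exact (Equiv.addRight c).iSup_congr fun _ => rfl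

lemma exists_isEnumeration_formEigenspace {b : ℕ → H}
    (hb : Orthonormal ℝ b) (hJ : ∀ (N : ℕ) (k : K), ‖J k‖ ^ 2
      ≤ ∑ i ∈ Finset.range N, inner ℝ (b i) (J k) ^ 2 + ‖k‖ ^ 2 / (2 * (N : ℝ) + 2))
    (hd : ∀ x, (∀ k, inner ℝ x (J k) = 0) → x = 0) (c : ℝ) :
    ∃ lam, IsEnumeration (fun μ => formEigenspace J (μ + c)) lam := by
  have hc := isCompactOperator_of_norm_sq_le hb hJ
  have : ∀ μ, FiniteDimensional ℝ (formEigenspace J (μ + c)) := fun μ =>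
    finiteDimensional_formEigenspace hc _
  have hon := orthonormal_eigenSystem (formEigenspace_shift_orthogonal J c)
  have hsp := span_eigenSystem_orthogonal (iSup_formEigenspace_shift_orthogonal (c := c) hc hd)
  -- A finite complete system would make `H` finite-dimensional, against the infinite orthonormal
  -- family `b`.
  have : Infinite (EigenIndex fun μ => formEigenspace J (μ + c)) := by
    by_contra hfin
    rw [not_infinite_iff_finite] at hfin
    have := FiniteDimensional.span_of_finite ℝ
      (Set.finite_range (eigenSystem fun μ => formEigenspace J (μ + c)))
    rw [Submodule.orthogonal_eq_bot_iff] at hsp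
    rw [hsp] at this
    have : FiniteDimensional ℝ H := Module.finite_def.2 (Submodule.fg_top _ |>.1 this.fg_top)
    have := hb.linearIndependent.finite
    exact not_finite ℕ
  refine exists_isEnumeration fun L => ?_
  have := finite_setOf_le_of_norm_sq_le hb hJ hon (Λ := fun i => i.1 + c)
    (fun i => eigenSystem_mem _ i) (L + c)
  simpa using this

lemma sum_le_of_isEnumeration (hc : IsCompactOperator J)
    (hd : ∀ x, (∀ k, inner ℝ x (J k) = 0) → x = 0) {lam : ℕ → ℝ}
    (hlam : IsEnumeration (fun μ => formEigenspace J (μ + c)) lam) {p : ℕ → K}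
    (hp : Orthonormal ℝ fun i => J (p i)) (n : ℕ) :
    ∑ j ∈ Finset.range (n + 1), (lam j + c) ≤ ∑ i ∈ Finset.range (n + 1), ‖p i‖ ^ 2 := by
  have : ∀ μ, FiniteDimensional ℝ (formEigenspace J (μ + c)) := fun μ =>
    finiteDimensional_formEigenspace hc _
  obtain ⟨e, he⟩ := hlam.exists_equiv
  have hon := orthonormal_eigenSystem (formEigenspace_shift_orthogonal J c)
  have hsp := span_eigenSystem_orthogonal (iSup_formEigenspace_shift_orthogonal (c := c) hc hd)
  refine sum_le_sum_norm_sq (hon.comp e e.injective) ?_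
    (fun i j hij => add_le_add_left (hlam.monotone hij) c) (fun i => ?_) hp n
  · rwa [Set.range_comp, e.surjective.range_eq, Set.image_univ]
  · have := eigenSystem_mem (fun μ => formEigenspace J (μ + c)) (e i)
    rwa [he] at this

end Compact

lemma L2_inner_eq_integral (u v : L2) : inner ℝ u v = ∫ x, u x * v x := by
  rw [L2.inner_def]
  simp [mul_comm]

lemma L2_norm_sq_eq_integral (u : L2) : ‖u‖ ^ 2 = ∫ x, u x * u x := by
  rw [← real_inner_self_eq_norm_sq, L2_inner_eq_integral]

lemma integral_mul_congr {u v f g : ℝ → ℝ} (h : u =ᵐ[volume] f) (h' : v =ᵐ[volume] g) :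
    ∫ x, u x * v x = ∫ x, f x * g x := integral_congr_ae (h.mul h')

lemma continuous_integral_L2_mul {f : ℝ → ℝ} (hf : MemLp f 2 volume) :
    Continuous fun u : L2 => ∫ x, u x * f x := by
  have : (fun u : L2 => ∫ x, u x * f x) = fun u : L2 => inner ℝ u hf.toLp := funext fun u => by
    rw [L2_inner_eq_integral]
    exact (integral_mul_congr EventuallyEq.rfl hf.coeFn_toLp).symm
  rw [this]
  fun_prop

/-! ### The form space -/

/-- Triples of square integrable functions. -/
abbrev L2Triple : Type := WithLp 2 (L2 × WithLp 2 (L2 × L2))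

/-- The space of triples `(u, u', s u)`. For `s = √(1 + V)` up to constants, this is the form domain
of `-d²/dx² + V` equipped with the graph inner product of the quadratic form. -/
def formSpace (s : ℝ → ℝ) : Submodule ℝ L2Triple where
  carrier := {k | IsWeakDeriv k.fst k.snd.fst ∧ k.snd.snd =ᵐ[volume] fun x => s x * k.fst x}
  zero_mem' := by
    refine ⟨IsWeakDeriv.zero, ?_⟩
    filter_upwards [Lp.coeFn_zero ℝ 2 (volume : Measure ℝ)] with x hx
    simp
  add_mem' := by
    rintro k l ⟨h1, h2⟩ ⟨h3, h4⟩
    refine ⟨h1.add h3, ?_⟩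
    filter_upwards [h2, h4, Lp.coeFn_add k.snd.snd l.snd.snd, Lp.coeFn_add k.fst l.fst]
      with x a b c d
    simp only [WithLp.add_snd, WithLp.add_fst, c, d, Pi.add_apply, a, b]
    ring
  smul_mem' := by
    rintro c k ⟨h1, h2⟩
    refine ⟨h1.smul c, ?_⟩
    filter_upwards [h2, Lp.coeFn_smul c k.snd.snd, Lp.coeFn_smul c k.fst] with x a b d
    simp only [WithLp.smul_snd, WithLp.smul_fst, b, d, Pi.smul_apply, a, smul_eq_mul]
    ring

lemma isClosed_setOf_isWeakDeriv : IsClosed {p : L2 × L2 | IsWeakDeriv p.1 p.2} := by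
  have : {p : L2 × L2 | IsWeakDeriv p.1 p.2} = ⋂ (φ : ℝ → ℝ) (_ : ContDiff ℝ ∞ φ)
      (_ : HasCompactSupport φ), {p | ∫ x, p.1 x * deriv φ x = -∫ x, p.2 x * φ x} := by
    ext p
    simp [IsWeakDeriv]
  rw [this]
  refine isClosed_iInter fun φ => isClosed_iInter fun hφ => isClosed_iInter fun hc => ?_
  have h1 : MemLp (deriv φ) 2 volume :=
    (hφ.continuous_deriv (by simp)).memLp_of_hasCompactSupport hc.deriv
  have h2 : MemLp φ 2 volume := hφ.continuous.memLp_of_hasCompactSupport hc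
  exact isClosed_eq ((continuous_integral_L2_mul h1).comp continuous_fst)
    ((continuous_integral_L2_mul h2).comp continuous_snd).neg

/-- Multiplication by an unbounded `s` is not continuous on `L²`, so the relation is passed to the
limit almost everywhere along a subsequence extracted twice. -/
lemma isClosed_setOf_ae_eq_mul (s : ℝ → ℝ) :
    IsClosed {p : L2 × L2 | p.2 =ᵐ[volume] fun x => s x * p.1 x} := by
  refine IsSeqClosed.isClosed fun p q hp hq => ?_
  have h1 : Tendsto (fun n => (p n).1) atTop (𝓝 q.1) := (continuous_fst.tendsto q).comp hq
  have h2 : Tendsto (fun n => (p n).2) atTop (𝓝 q.2) := (continuous_snd.tendsto q).comp hq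
  obtain ⟨ns, hns, h3⟩ := (tendstoInMeasure_of_tendsto_Lp h1).exists_seq_tendsto_ae
  obtain ⟨ms, hms, h4⟩ :=
    (tendstoInMeasure_of_tendsto_Lp (h2.comp hns.tendsto_atTop)).exists_seq_tendsto_ae
  have h5 : ∀ᵐ x, ∀ n, (p n).2 x = s x * (p n).1 x := ae_all_iff.2 hp
  change q.2 =ᵐ[volume] fun x => s x * q.1 x
  filter_upwards [h3, h4, h5] with x a b c
  refine tendsto_nhds_unique b ?_
  have := (a.comp hms.tendsto_atTop).const_mul (s x)
  refine this.congr fun n => ?_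
  simp [c]

instance (s : ℝ → ℝ) : CompleteSpace (formSpace s) := by
  have h : IsClosed (formSpace s : Set L2Triple) := by
    have h1 : Continuous fun k : L2Triple => (k.fst, k.snd.fst) := by fun_prop
    have h2 : Continuous fun k : L2Triple => (k.fst, k.snd.snd) := by fun_prop
    exact (isClosed_setOf_isWeakDeriv.preimage h1).inter
      ((isClosed_setOf_ae_eq_mul s).preimage h2)
  exact h.completeSpace_coe

/-- Bounded operators between real inner product spaces, with the topologies of the norms. -/
abbrev BoundedOperator (K H : Type*) [NormedAddCommGroup K] [InnerProductSpace ℝ K]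
    [NormedAddCommGroup H] [InnerProductSpace ℝ H] : Type _ := K →L[ℝ] H

/-- The embedding of the form space into `L²(ℝ)`. -/
def formEmbedding (s : ℝ → ℝ) : BoundedOperator (formSpace s) L2 :=
  (WithLp.fstL 2 ℝ L2 (WithLp 2 (L2 × L2))).comp (formSpace s).subtypeL

/-- The element `(u, g, w)` of the form space. -/
def formSpace.mk {s : ℝ → ℝ} (u g w : L2) (h : IsWeakDeriv u g)
    (hw : w =ᵐ[volume] fun x => s x * u x) : formSpace s :=
  ⟨WithLp.toLp 2 (u, WithLp.toLp 2 (g, w)), h, hw⟩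

lemma formEmbedding_apply {s : ℝ → ℝ} (k : formSpace s) : formEmbedding s k = k.1.fst := rfl

lemma formSpace_inner {s : ℝ → ℝ} (k l : formSpace s) : inner ℝ k l
    = inner ℝ k.1.fst l.1.fst + (inner ℝ k.1.snd.fst l.1.snd.fst
      + inner ℝ k.1.snd.snd l.1.snd.snd) := by
  rw [Submodule.coe_inner, WithLp.prod_inner_apply, WithLp.prod_inner_apply]
  rfl

lemma formSpace_norm_sq {s : ℝ → ℝ} (k : formSpace s) : ‖k‖ ^ 2
    = ‖k.1.fst‖ ^ 2 + (‖k.1.snd.fst‖ ^ 2 + ‖k.1.snd.snd‖ ^ 2) := by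
  simp only [← real_inner_self_eq_norm_sq, formSpace_inner]

/-! ### Weak derivatives and Gaussians -/

lemma integral_gaussPoly_mul_deriv (p : ℝ[X]) {φ : ℝ → ℝ} (hφ : ContDiff ℝ ∞ φ)
    (hc : HasCompactSupport φ) : ∫ x, gaussPoly p x * deriv φ x
      = -∫ x, gaussPoly (derivative p - X * p) x * φ x := by
  have hd : Continuous (deriv φ) := hφ.continuous_deriv (by simp)
  have hc' := continuous_gaussPoly p
  refine integral_mul_deriv_eq_deriv_mul_of_integrable
    (fun x _ => hasDerivAt_gaussPoly p x)
    (fun x _ => ((hφ.differentiable (by simp)) x).hasDerivAt) ?_ ?_ ?_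
  · exact (hc'.mul hd).integrable_of_hasCompactSupport hc.deriv.mul_left
  · exact ((continuous_gaussPoly _).mul hφ.continuous).integrable_of_hasCompactSupport hc.mul_left
  · exact (hc'.mul hφ.continuous).integrable_of_hasCompactSupport hc.mul_left

/-- `p(x) exp(-x²/2)` as an element of `L²(ℝ)`. -/
def gaussPolyL2 (p : ℝ[X]) : L2 := (memLp_gaussPoly p).toLp

lemma coeFn_gaussPolyL2 (p : ℝ[X]) : gaussPolyL2 p =ᵐ[volume] gaussPoly p :=
  (memLp_gaussPoly p).coeFn_toLp

lemma isWeakDeriv_gaussPolyL2 (p : ℝ[X]) :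
    IsWeakDeriv (gaussPolyL2 p) (gaussPolyL2 (derivative p - X * p)) := fun φ hφ hc => by
  rw [integral_mul_congr (coeFn_gaussPolyL2 _) (EventuallyEq.refl _ (deriv φ)),
    integral_mul_congr (coeFn_gaussPolyL2 _) (EventuallyEq.refl _ φ),
    integral_gaussPoly_mul_deriv p hφ hc]

/-- Integration by parts against `p(x) exp(-x²/2)` for weakly differentiable functions. -/
lemma IsWeakDeriv.integral_mul_gaussPoly {u g : L2} (h : IsWeakDeriv u g) (p : ℝ[X]) :
    ∫ x, u x * gaussPoly (derivative p - X * p) x = -∫ x, g x * gaussPoly p x := by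
  set G := gaussPoly p with hG
  set G' := gaussPoly (derivative p - X * p) with hG'
  have hGd : ∀ x, HasDerivAt G (G' x) x := hasDerivAt_gaussPoly p
  -- The Gaussian is not compactly supported, so it is cut off by `χ(x / (n + 1))`; differentiating
  -- the cutoff produces a factor `1 / (n + 1)`, which removes that term in the limit.
  let χ : ContDiffBump (0 : ℝ) := ⟨1, 2, one_pos, one_lt_two⟩
  have hχ : ContDiff ℝ ∞ χ := χ.contDiff
  have hχd : Continuous (deriv χ) := hχ.continuous_deriv (by simp)
  obtain ⟨C, hC⟩ := hχd.bounded_above_of_compact_support χ.hasCompactSupport.deriv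
  set a : ℕ → ℝ := fun n => ((n : ℝ) + 1)⁻¹ with ha
  have ha0 : ∀ n, 0 < a n := fun n => by simp only [ha]; positivity
  have ha1 : ∀ n, a n ≤ 1 := fun n => by
    simp only [ha]
    exact inv_le_one_of_one_le₀ (by linarith [n.cast_nonneg (α := ℝ)])
  have halim : Tendsto a atTop (𝓝 0) := by
    simpa [ha] using tendsto_one_div_add_atTop_nhds_zero_nat (𝕜 := ℝ)
  set φ : ℕ → ℝ → ℝ := fun n x => χ (a n * x) * G x with hφ
  have hscale : ∀ n x, HasDerivAt (fun x => χ (a n * x)) (deriv χ (a n * x) * a n) x := fun n x => by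
    have h1 : HasDerivAt χ (deriv χ (a n * x)) (a n * x) :=
      ((hχ.differentiable (by simp)) _).hasDerivAt
    have h2 : HasDerivAt (fun x => a n * x) (a n) x := by
      simpa using (hasDerivAt_id x).const_mul (a n)
    exact h1.comp x h2
  have hφd : ∀ n x, deriv (φ n) x = deriv χ (a n * x) * a n * G x + χ (a n * x) * G' x :=
    fun n x => ((hscale n x).mul (hGd x)).deriv
  have hφs : ∀ n, ContDiff ℝ ∞ (φ n) := fun n =>
    (hχ.comp (contDiff_const.mul contDiff_id)).mul (contDiff_gaussPoly p)
  have hφc : ∀ n, HasCompactSupport (φ n) := fun n => by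
    refine HasCompactSupport.mul_right ?_
    exact χ.hasCompactSupport.comp_homeomorph (Homeomorph.mulLeft₀ (a n) (ha0 n).ne')
  have hχ1 : ∀ y, ‖χ y‖ ≤ 1 := fun y => by
    rw [Real.norm_of_nonneg χ.nonneg]; exact χ.le_one
  have hev : ∀ x : ℝ, Tendsto (fun n => a n * x) atTop (𝓝 0) := fun x => by
    simpa using halim.mul_const x
  have hχlim : ∀ x : ℝ, Tendsto (fun n => χ (a n * x)) atTop (𝓝 1) := fun x => by
    have h1 : χ (0 : ℝ) = 1 := χ.one_of_mem_closedBall (by simp [χ])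
    rw [← h1]
    exact (hχ.continuous.tendsto 0).comp (hev x)
  have hL : Tendsto (fun n => ∫ x, u x * deriv (φ n) x) atTop (𝓝 (∫ x, u x * G' x)) := by
    refine tendsto_integral_of_dominated_convergence
      (fun x => C * ‖u x * G x‖ + ‖u x * G' x‖) (fun n => ?_) ?_ (fun n => ?_) ?_
    · exact (Lp.aestronglyMeasurable u).mul
        ((hφs n).continuous_deriv (by simp)).aestronglyMeasurable
    · exact ((integrable_L2_mul_gaussPoly u p).norm.const_mul C).add
        (integrable_L2_mul_gaussPoly u _).norm
    · refine Eventually.of_forall fun x => ?_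
      rw [hφd]
      have e : u x * (deriv χ (a n * x) * a n * G x + χ (a n * x) * G' x)
          = (deriv χ (a n * x) * a n) * (u x * G x) + χ (a n * x) * (u x * G' x) := by ring
      rw [e]
      refine (norm_add_le _ _).trans (add_le_add ?_ ?_)
      · rw [norm_mul, norm_mul, Real.norm_of_nonneg (ha0 n).le]
        refine mul_le_mul_of_nonneg_right ?_ (norm_nonneg _)
        exact (mul_le_of_le_one_right (norm_nonneg _) (ha1 n)).trans (hC _)
      · rw [norm_mul]
        exact mul_le_of_le_one_left (norm_nonneg _) (hχ1 _)
    · refine Eventually.of_forall fun x => ?_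
      simp only [hφd]
      have h1 := ((((hχd.tendsto 0).comp (hev x)).mul halim).mul_const (G x)).add
        ((hχlim x).mul_const (G' x))
      simpa using h1.const_mul (u x)
  have hR : Tendsto (fun n => ∫ x, g x * φ n x) atTop (𝓝 (∫ x, g x * G x)) := by
    refine tendsto_integral_of_dominated_convergence (fun x => ‖g x * G x‖) (fun n => ?_) ?_
      (fun n => ?_) ?_
    · exact (Lp.aestronglyMeasurable g).mul (hφs n).continuous.aestronglyMeasurable
    · exact (integrable_L2_mul_gaussPoly g p).norm
    · refine Eventually.of_forall fun x => ?_
      rw [hφ, mul_left_comm, norm_mul]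
      exact mul_le_of_le_one_left (norm_nonneg _) (hχ1 _)
    · refine Eventually.of_forall fun x => ?_
      simpa [hφ] using ((hχlim x).mul_const (G x)).const_mul (g x)
  refine tendsto_nhds_unique hL ?_
  exact hR.neg.congr fun n => (h (φ n) (hφs n) (hφc n)).symm

/-! ### The unperturbed oscillator -/

/-- The polynomial factor of the `n`-th Hermite function. -/
def psiPoly (n : ℕ) : ℝ[X] := C (hermiteConst n) * hermitePoly n

lemma psi_eq_gaussPoly (n : ℕ) : psi n = gaussPoly (psiPoly n) := rfl

/-- The polynomial factor of the derivative of the `n`-th Hermite function. -/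
def dpsiPoly (n : ℕ) : ℝ[X] := derivative (psiPoly n) - X * psiPoly n

/-- The `n`-th Hermite function as an element of `L²(ℝ)`. -/
def psiL2 (n : ℕ) : L2 := gaussPolyL2 (psiPoly n)

lemma coeFn_psiL2 (n : ℕ) : psiL2 n =ᵐ[volume] psi n := coeFn_gaussPolyL2 _

lemma isWeakDeriv_psiL2 (n : ℕ) : IsWeakDeriv (psiL2 n) (gaussPolyL2 (dpsiPoly n)) :=
  isWeakDeriv_gaussPolyL2 _

/-- The oscillator equation `ψ_n'' = (x² - (2n + 1)) ψ_n`, with the Gaussian factor removed. -/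
lemma psi_ode (n : ℕ) : derivative (dpsiPoly n) - X * dpsiPoly n
    = X * (X * psiPoly n) + C (-(2 * (n : ℝ) + 1)) * psiPoly n := by
  simp only [dpsiPoly, psiPoly, derivative_sub, derivative_mul, derivative_C, zero_mul, zero_add,
    derivative_derivative_hermitePoly, derivative_X]
  simp
  rw [show (C 2 : ℝ[X]) = 2 from rfl]
  ring

lemma orthonormal_psiL2 : Orthonormal ℝ psiL2 := by
  rw [orthonormal_iff_ite]
  intro i j
  rw [L2_inner_eq_integral, integral_mul_congr (coeFn_psiL2 i) (coeFn_psiL2 j),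
    integral_psi_mul_psi]

lemma span_psiL2_orthogonal : (Submodule.span ℝ (Set.range psiL2))ᗮ = ⊥ := by
  refine (Submodule.eq_bot_iff _).2 fun f hf => eq_zero_of_integral_mul_psi_eq_zero fun n => ?_
  have := Submodule.inner_left_of_mem_orthogonal (Submodule.subset_span ⟨n, rfl⟩ :
    psiL2 n ∈ Submodule.span ℝ (Set.range psiL2)) hf
  rw [← this, L2_inner_eq_integral]
  exact (integral_mul_congr EventuallyEq.rfl (coeFn_psiL2 n)).symm

/-- The `n`-th Hermite function as an element of the form space of the oscillator. -/
def psiForm (n : ℕ) : formSpace id :=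
  formSpace.mk (psiL2 n) (gaussPolyL2 (dpsiPoly n)) (gaussPolyL2 (X * psiPoly n))
    (isWeakDeriv_psiL2 n) (by
      filter_upwards [coeFn_psiL2 n, coeFn_gaussPolyL2 (X * psiPoly n)] with x h1 h2
      rw [h2, gaussPoly_X_mul, h1]
      rfl)

lemma formEmbedding_psiForm (n : ℕ) : formEmbedding id (psiForm n) = psiL2 n := rfl

/-- Integration by parts moves the weak derivative onto `ψ_n'`, and `psi_ode` applies. The constant
is `(2n + 1) + 1`, since the inner product of the form space includes that of `L²`. -/
lemma inner_psiForm (n : ℕ) (k : formSpace id) :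
    inner ℝ (psiForm n) k = (2 * (n : ℝ) + 2) * inner ℝ (psiL2 n) (formEmbedding id k) := by
  have h1 := k.2.1.integral_mul_gaussPoly (dpsiPoly n)
  rw [psi_ode] at h1
  have h2 : ∫ x, k.1.fst x * gaussPoly (X * (X * psiPoly n)
      + C (-(2 * (n : ℝ) + 1)) * psiPoly n) x
      = (∫ x, k.1.fst x * gaussPoly (X * (X * psiPoly n)) x)
        - (2 * (n : ℝ) + 1) * ∫ x, k.1.fst x * gaussPoly (psiPoly n) x := by
    rw [← integral_const_mul, ← integral_sub (integrable_L2_mul_gaussPoly _ _)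
      ((integrable_L2_mul_gaussPoly _ _).const_mul _)]
    refine integral_congr_ae (Eventually.of_forall fun x => ?_)
    simp only [gaussPoly_add, gaussPoly_C_mul]
    ring
  have h3 : inner ℝ (gaussPolyL2 (X * psiPoly n)) k.1.snd.snd
      = ∫ x, k.1.fst x * gaussPoly (X * (X * psiPoly n)) x := by
    rw [L2_inner_eq_integral]
    refine integral_congr_ae ?_
    filter_upwards [coeFn_gaussPolyL2 (X * psiPoly n), k.2.2] with x h4 h5
    rw [h4, h5, gaussPoly_X_mul (X * psiPoly n), id]
    ring
  have h4 : ∀ (f : L2) (p : ℝ[X]), inner ℝ (gaussPolyL2 p) f = ∫ x, f x * gaussPoly p x :=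
    fun f p => by
      rw [real_inner_comm, L2_inner_eq_integral]
      exact integral_mul_congr EventuallyEq.rfl (coeFn_gaussPolyL2 p)
  rw [formSpace_inner, formEmbedding_apply]
  change inner ℝ (gaussPolyL2 (psiPoly n)) k.1.fst + (inner ℝ (gaussPolyL2 (dpsiPoly n)) k.1.snd.fst
    + inner ℝ (gaussPolyL2 (X * psiPoly n)) k.1.snd.snd)
    = (2 * (n : ℝ) + 2) * inner ℝ (gaussPolyL2 (psiPoly n)) k.1.fst
  rw [h3, h4, h4]
  linarith

lemma psiL2_mem_formEigenspace (n : ℕ) :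
    psiL2 n ∈ formEigenspace (formEmbedding id) (2 * (n : ℝ) + 2) :=
  ⟨psiForm n, formEmbedding_psiForm n, inner_psiForm n⟩

lemma psiForm_norm_sq (n : ℕ) : ‖psiForm n‖ ^ 2 = 2 * (n : ℝ) + 2 := by
  rw [← real_inner_self_eq_norm_sq, inner_psiForm, formEmbedding_psiForm,
    real_inner_self_eq_norm_sq, orthonormal_psiL2.1]
  ring

/-- The quantitative Rellich estimate for potentials above the harmonic one. -/
lemma formEmbedding_norm_sq_le {s : ℝ → ℝ} (hs : ∀ᵐ x : ℝ, |x| ≤ |s x|) (N : ℕ)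
    (k : formSpace s) : ‖formEmbedding s k‖ ^ 2
      ≤ ∑ i ∈ Finset.range N, inner ℝ (psiL2 i) (formEmbedding s k) ^ 2
        + ‖k‖ ^ 2 / (2 * (N : ℝ) + 2) := by
  have hle : ∀ᵐ x, ‖x * k.1.fst x‖ ≤ ‖k.1.snd.snd x‖ := by
    filter_upwards [hs, k.2.2] with x h1 h2
    rw [h2, norm_mul, norm_mul]
    exact mul_le_mul_of_nonneg_right h1 (norm_nonneg _)
  have hm : MemLp (fun x => x * k.1.fst x) 2 volume :=
    (Lp.memLp k.1.snd.snd).mono (continuous_id.aestronglyMeasurable.mul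
      (Lp.aestronglyMeasurable _)) hle
  -- Replacing `s u` by `x u` gives an element of the oscillator's form space with the same image in
  -- `L²` and no larger norm.
  set k₀ : formSpace id := formSpace.mk k.1.fst k.1.snd.fst hm.toLp k.2.1 hm.coeFn_toLp
  have hk₀ : formEmbedding id k₀ = formEmbedding s k := rfl
  have hnorm : ‖k₀‖ ^ 2 ≤ ‖k‖ ^ 2 := by
    rw [formSpace_norm_sq, formSpace_norm_sq]
    have : ‖hm.toLp‖ ≤ ‖k.1.snd.snd‖ := by
      refine Lp.norm_le_norm_of_ae_le ?_
      filter_upwards [hm.coeFn_toLp, hle] with x h1 h2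
      rwa [h1]
    have h2 : ‖hm.toLp‖ ^ 2 ≤ ‖k.1.snd.snd‖ ^ 2 := pow_le_pow_left₀ (norm_nonneg _) this 2
    change ‖k.1.fst‖ ^ 2 + (‖k.1.snd.fst‖ ^ 2 + ‖hm.toLp‖ ^ 2) ≤ _
    linarith
  have hmono : Monotone fun n : ℕ => 2 * (n : ℝ) + 2 := fun m n h => by
    have : (m : ℝ) ≤ n := by exact_mod_cast h
    simp only
    linarith
  have := norm_sq_le_of_complete orthonormal_psiL2 span_psiL2_orthogonal hmono
    (fun i => by positivity) psiL2_mem_formEigenspace N k₀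
  rw [hk₀] at this
  refine this.trans (add_le_add_right ?_ _)
  exact div_le_div_of_nonneg_right hnorm (by positivity)

/-! ### The perturbed oscillator. -/

/-- The weight `√(x² + q + q_m)`, which turns the potential into a square. -/
def formWeight (q : ℝ → ℝ) (q_m : ℝ) (x : ℝ) : ℝ := √(x ^ 2 + q x + q_m)

section Perturbed

variable {q : ℝ → ℝ} {q_m : ℝ}

/-- As `e^{-x²} ≤ 1`, the sign condition gives `q + q_m ≥ 0`; the radicand is then at least `x²`. -/
lemma formWeight_sq (hm : 0 ≤ q_m) (hpos : ∀ᵐ x : ℝ, 0 ≤ q x + q_m * Real.exp (-x ^ 2)) :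
    ∀ᵐ x, formWeight q q_m x ^ 2 = x ^ 2 + q x + q_m ∧ |x| ≤ |formWeight q q_m x| := by
  filter_upwards [hpos] with x hx
  have h1 : Real.exp (-x ^ 2) ≤ 1 := by
    rw [Real.exp_le_one_iff]
    nlinarith [sq_nonneg x]
  have h2 : 0 ≤ q x + q_m := by nlinarith
  have h3 : formWeight q q_m x ^ 2 = x ^ 2 + q x + q_m := Real.sq_sqrt (by nlinarith [sq_nonneg x])
  refine ⟨h3, sq_le_sq.1 ?_⟩
  rw [h3]
  linarith

lemma aestronglyMeasurable_formWeight (hq : Integrable q) :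
    AEStronglyMeasurable (formWeight q q_m) volume := by
  refine Real.continuous_sqrt.comp_aestronglyMeasurable ?_
  exact ((continuous_pow 2).aestronglyMeasurable.add hq.aestronglyMeasurable).add
    aestronglyMeasurable_const

lemma integrable_L2_sq (u : L2) : Integrable fun x => u x ^ 2 := by
  simpa only [sq] using integrable_mul_L2 u u

lemma fst_mem_formDomain (hm : 0 ≤ q_m)
    (hpos : ∀ᵐ x : ℝ, 0 ≤ q x + q_m * Real.exp (-x ^ 2)) (k : formSpace (formWeight q q_m)) :
    k.1.fst ∈ formDomain fun x => x ^ 2 + q x := by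
  refine ⟨⟨_, k.2.1⟩, ?_⟩
  refine ((integrable_L2_sq k.1.snd.snd).sub ((integrable_L2_sq k.1.fst).const_mul q_m)).congr ?_
  filter_upwards [k.2.2, formWeight_sq hm hpos] with x h1 h2
  simp only [Pi.sub_apply]
  rw [h1, mul_pow, h2.1]
  ring

lemma exists_formSpace_lift (hq : Integrable q) (hm : 0 ≤ q_m)
    (hpos : ∀ᵐ x : ℝ, 0 ≤ q x + q_m * Real.exp (-x ^ 2)) {u g : L2}
    (hu : u ∈ formDomain fun x => x ^ 2 + q x) (hg : IsWeakDeriv u g) :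
    ∃ k : formSpace (formWeight q q_m), k.1.fst = u ∧ k.1.snd.fst = g := by
  have hw : MemLp (fun x => formWeight q q_m x * u x) 2 volume := by
    have hmeas : AEStronglyMeasurable (fun x => formWeight q q_m x * u x) volume :=
      (aestronglyMeasurable_formWeight hq).mul (Lp.aestronglyMeasurable u)
    rw [memLp_two_iff_integrable_sq hmeas]
    refine (hu.2.add ((integrable_L2_sq u).const_mul q_m)).congr ?_
    filter_upwards [formWeight_sq hm hpos] with x h
    simp only [Pi.add_apply]
    rw [mul_pow, h.1]
    ring
  exact ⟨formSpace.mk u g hw.toLp hg hw.coeFn_toLp, rfl, rfl⟩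

/-- Explains the spectral shift `q_m + 1`: `q_m` comes from the weight and `1` from the `L²`
component of the triple. -/
lemma formSpace_inner_eq (hm : 0 ≤ q_m)
    (hpos : ∀ᵐ x : ℝ, 0 ≤ q x + q_m * Real.exp (-x ^ 2)) (k l : formSpace (formWeight q q_m)) :
    inner ℝ k l = (∫ x, k.1.snd.fst x * l.1.snd.fst x)
      + (∫ x, (x ^ 2 + q x) * (k.1.fst x * l.1.fst x))
      + (q_m + 1) * ∫ x, k.1.fst x * l.1.fst x := by
  have h : ∫ x, k.1.snd.snd x * l.1.snd.snd x
      = (∫ x, (x ^ 2 + q x) * (k.1.fst x * l.1.fst x))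
        + q_m * ∫ x, k.1.fst x * l.1.fst x := by
    have hV := integrable_potential_mul (V := fun x => x ^ 2 + q x)
      (Lp.aestronglyMeasurable k.1.fst) (Lp.aestronglyMeasurable l.1.fst)
      (fst_mem_formDomain hm hpos k).2 (fst_mem_formDomain hm hpos l).2
    rw [← integral_const_mul, ← integral_add hV ((integrable_mul_L2 _ _).const_mul _)]
    refine integral_congr_ae ?_
    filter_upwards [k.2.2, l.2.2, formWeight_sq hm hpos] with x h1 h2 h3
    rw [h1, h2]
    linear_combination (k.1.fst x * l.1.fst x) * h3.1
  rw [formSpace_inner, L2_inner_eq_integral, L2_inner_eq_integral, L2_inner_eq_integral, h]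
  ring

lemma eigenspace_eq_formEigenspace (hq : Integrable q) (hm : 0 ≤ q_m)
    (hpos : ∀ᵐ x : ℝ, 0 ≤ q x + q_m * Real.exp (-x ^ 2)) (μ : ℝ) :
    eigenspace (fun x => x ^ 2 + q x) μ = formEigenspace
      (formEmbedding (formWeight q q_m)) (μ + (q_m + 1)) := by
  have hsmul : ∀ u v : L2, ∫ x, (μ • u : L2) x * v x = μ * ∫ x, u x * v x := fun u v => by
    rw [← L2_inner_eq_integral, real_inner_smul_left, L2_inner_eq_integral]
  ext u
  constructor
  · rintro ⟨hu, g, hg, h⟩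
    obtain ⟨k, rfl, rfl⟩ := exists_formSpace_lift hq hm hpos hu hg
    refine ⟨k, rfl, fun l => ?_⟩
    have h1 := h _ (fst_mem_formDomain hm hpos l) _ l.2.1
    change _ = ∫ x, (μ • k.1.fst : L2) x * l.1.fst x at h1
    rw [hsmul] at h1
    rw [formSpace_inner_eq hm hpos, formEmbedding_apply, L2_inner_eq_integral]
    change _ + (∫ x, (x ^ 2 + q x) * (k.1.fst x * l.1.fst x)) = _ at h1
    linarith
  · rintro ⟨k, rfl, h⟩
    refine ⟨fst_mem_formDomain hm hpos k, k.1.snd.fst, k.2.1, fun v hv g hg => ?_⟩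
    obtain ⟨l, rfl, rfl⟩ := exists_formSpace_lift hq hm hpos hv hg
    have h1 := h l
    rw [formSpace_inner_eq hm hpos, formEmbedding_apply, formEmbedding_apply,
      L2_inner_eq_integral] at h1
    change _ + (∫ x, (x ^ 2 + q x) * (k.1.fst x * l.1.fst x))
      = ∫ x, (μ • k.1.fst : L2) x * l.1.fst x
    rw [hsmul]
    linarith

lemma psi_sq_le (n : ℕ) (x : ℝ) : psi n x ^ 2 ≤ omega n / Real.pi :=
  (Finset.single_le_sum (f := fun k => psi k x ^ 2) (fun _ _ => sq_nonneg _)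
    (Finset.self_mem_range_succ n)).trans (sum_psi_sq_le_omega n x)

lemma integrable_mul_psi_sq (hq : Integrable q) (n : ℕ) : Integrable fun x => q x * psi n x ^ 2 :=
  hq.mul_bdd ((continuous_psi n).pow 2).aestronglyMeasurable (c := omega n / Real.pi)
    (Eventually.of_forall fun x => by
      rw [Real.norm_of_nonneg (sq_nonneg _)]
      exact psi_sq_le n x)

lemma integrable_sq_mul_psi_sq (n : ℕ) : Integrable fun x => x ^ 2 * psi n x ^ 2 := by
  refine (integrable_gaussPoly_mul (X * psiPoly n) (X * psiPoly n)).congr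
    (Eventually.of_forall fun x => ?_)
  simp only [gaussPoly_X_mul, psi_eq_gaussPoly]
  ring

lemma psiL2_mem_formDomain (hq : Integrable q) (n : ℕ) :
    psiL2 n ∈ formDomain fun x => x ^ 2 + q x := by
  refine ⟨⟨_, isWeakDeriv_psiL2 n⟩, ?_⟩
  refine ((integrable_sq_mul_psi_sq n).add (integrable_mul_psi_sq hq n)).congr ?_
  filter_upwards [coeFn_psiL2 n] with x h
  simp only [Pi.add_apply]
  rw [h]
  ring

/-- The energy of `ψ_n`, read off from `psiForm_norm_sq` by removing the `L²` norm, which is `1`. -/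
lemma integral_dpsi_sq (n : ℕ) : (∫ x, gaussPolyL2 (dpsiPoly n) x * gaussPolyL2 (dpsiPoly n) x)
    + ∫ x, x ^ 2 * psi n x ^ 2 = 2 * (n : ℝ) + 1 := by
  have h := psiForm_norm_sq n
  rw [formSpace_norm_sq] at h
  change ‖psiL2 n‖ ^ 2 + (‖gaussPolyL2 (dpsiPoly n)‖ ^ 2 + ‖gaussPolyL2 (X * psiPoly n)‖ ^ 2) = _
    at h
  rw [orthonormal_psiL2.1, L2_norm_sq_eq_integral, L2_norm_sq_eq_integral,
    integral_mul_congr (coeFn_gaussPolyL2 (X * psiPoly n)) (coeFn_gaussPolyL2 (X * psiPoly n))] at h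
  have e : ∀ x, gaussPoly (X * psiPoly n) x * gaussPoly (X * psiPoly n) x
      = x ^ 2 * psi n x ^ 2 := fun x => by
    simp only [gaussPoly_X_mul, psi_eq_gaussPoly]
    ring
  simp only [e] at h
  linarith

lemma exists_lift_psiL2 (hq : Integrable q) (hm : 0 ≤ q_m)
    (hpos : ∀ᵐ x : ℝ, 0 ≤ q x + q_m * Real.exp (-x ^ 2)) (n : ℕ) :
    ∃ k : formSpace (formWeight q q_m), formEmbedding _ k = psiL2 n ∧
      ‖k‖ ^ 2 = lam0 n + (q_m + 1) + ∫ x, q x * psi n x ^ 2 := by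
  obtain ⟨k, h1, h2⟩ := exists_formSpace_lift hq hm hpos (psiL2_mem_formDomain hq n)
    (isWeakDeriv_psiL2 n)
  refine ⟨k, h1, ?_⟩
  have h3 : ∫ x, (x ^ 2 + q x) * (psiL2 n x * psiL2 n x)
      = (∫ x, x ^ 2 * psi n x ^ 2) + ∫ x, q x * psi n x ^ 2 := by
    rw [← integral_add (integrable_sq_mul_psi_sq n) (integrable_mul_psi_sq hq n)]
    refine integral_congr_ae ?_
    filter_upwards [coeFn_psiL2 n] with x h
    rw [h]
    ring
  rw [← real_inner_self_eq_norm_sq, formSpace_inner_eq hm hpos, h1, h2, h3,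
    ← L2_norm_sq_eq_integral (psiL2 n), orthonormal_psiL2.1, lam0, ← integral_dpsi_sq n]
  ring

lemma formEmbedding_norm_sq_le_formWeight (hm : 0 ≤ q_m)
    (hpos : ∀ᵐ x : ℝ, 0 ≤ q x + q_m * Real.exp (-x ^ 2)) (N : ℕ)
    (k : formSpace (formWeight q q_m)) : ‖formEmbedding _ k‖ ^ 2
      ≤ ∑ i ∈ Finset.range N, inner ℝ (psiL2 i) (formEmbedding _ k) ^ 2
        + ‖k‖ ^ 2 / (2 * (N : ℝ) + 2) :=
  formEmbedding_norm_sq_le ((formWeight_sq hm hpos).mono fun _ h => h.2) N k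

lemma isCompactOperator_formEmbedding (hm : 0 ≤ q_m)
    (hpos : ∀ᵐ x : ℝ, 0 ≤ q x + q_m * Real.exp (-x ^ 2)) :
    IsCompactOperator (formEmbedding (formWeight q q_m)) :=
  isCompactOperator_of_norm_sq_le
    orthonormal_psiL2 (formEmbedding_norm_sq_le_formWeight hm hpos)

/-- The form domain is dense because it contains the complete system of Hermite functions. -/
lemma eq_zero_of_inner_formEmbedding (hq : Integrable q) (hm : 0 ≤ q_m)
    (hpos : ∀ᵐ x : ℝ, 0 ≤ q x + q_m * Real.exp (-x ^ 2)) (f : L2)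
    (hf : ∀ k, inner ℝ f (formEmbedding (formWeight q q_m) k) = 0) : f = 0 := by
  refine eq_zero_of_integral_mul_psi_eq_zero fun n => ?_
  obtain ⟨k, hk, _⟩ := exists_lift_psiL2 hq hm hpos n
  rw [← hf k, hk, L2_inner_eq_integral]
  exact (integral_mul_congr EventuallyEq.rfl (coeFn_psiL2 n)).symm

lemma isEigenvalueSequence_iff (hq : Integrable q) (hm : 0 ≤ q_m)
    (hpos : ∀ᵐ x : ℝ, 0 ≤ q x + q_m * Real.exp (-x ^ 2)) (lam : ℕ → ℝ) :
    IsEigenvalueSequence (fun x => x ^ 2 + q x) lam ↔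
      IsEnumeration (fun μ => formEigenspace
        (formEmbedding (formWeight q q_m)) (μ + (q_m + 1))) lam := by
  constructor
  · intro h
    refine ⟨h.monotone, h.tendsto, fun μ => ?_⟩
    rw [← h.multiplicity μ, eigenspace_eq_formEigenspace hq hm hpos]
  · intro h
    refine ⟨h.monotone, h.tendsto, fun μ => ?_, fun μ => ?_⟩
    · rw [eigenspace_eq_formEigenspace hq hm hpos]
      exact finiteDimensional_formEigenspace (isCompactOperator_formEmbedding hm hpos) _
    · rw [← h.multiplicity μ, eigenspace_eq_formEigenspace hq hm hpos]

lemma exists_isEigenvalueSequence (hq : Integrable q) (hm : 0 ≤ q_m)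
    (hpos : ∀ᵐ x : ℝ, 0 ≤ q x + q_m * Real.exp (-x ^ 2)) :
    ∃ lam, IsEigenvalueSequence (fun x => x ^ 2 + q x) lam := by
  have h := exists_isEnumeration_formEigenspace
    (J := formEmbedding (formWeight q q_m)) orthonormal_psiL2
    (formEmbedding_norm_sq_le_formWeight hm hpos) (eq_zero_of_inner_formEmbedding hq hm hpos)
    (q_m + 1)
  obtain ⟨lam, hlam⟩ := h
  exact ⟨lam, (isEigenvalueSequence_iff hq hm hpos lam).2 hlam⟩

/-- The variational bound with the Hermite functions as trial functions. -/
lemma sum_eigenvalues_le (hq : Integrable q) (hm : 0 ≤ q_m)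
    (hpos : ∀ᵐ x : ℝ, 0 ≤ q x + q_m * Real.exp (-x ^ 2)) {lam : ℕ → ℝ}
    (hlam : IsEigenvalueSequence (fun x => x ^ 2 + q x) lam) (n : ℕ) :
    ∑ k ∈ Finset.range (n + 1), lam k
      ≤ ∑ k ∈ Finset.range (n + 1), (lam0 k + ∫ x, q x * psi k x ^ 2) := by
  choose p hp hp' using exists_lift_psiL2 hq hm hpos
  have hon : Orthonormal ℝ fun i => formEmbedding (formWeight q q_m) (p i) := by
    simp only [hp]
    exact orthonormal_psiL2
  have h := sum_le_of_isEnumeration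
    (J := formEmbedding (formWeight q q_m)) (c := q_m + 1) (isCompactOperator_formEmbedding hm hpos)
    (eq_zero_of_inner_formEmbedding hq hm hpos)
    ((isEigenvalueSequence_iff hq hm hpos lam).1 hlam) hon n
  simp only [hp', Finset.sum_add_distrib] at h
  rw [Finset.sum_add_distrib]
  linarith

/-- The pointwise bound needs a nonnegative weight, so `q_m e^{-x²}` is added to `q` and its exactly
known contribution subtracted at the end. -/
lemma sum_integral_mul_psi_sq_le (hq : Integrable q)
    (hpos : ∀ᵐ x : ℝ, 0 ≤ q x + q_m * Real.exp (-x ^ 2)) (n : ℕ) :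
    ∑ k ∈ Finset.range (n + 1), ∫ x, q x * psi k x ^ 2
      ≤ omega n / Real.pi * (∫ x, q x) + epsilon n * (q_m / √Real.pi) := by
  have h1 : (∑ k ∈ Finset.range (n + 1), ∫ x, q x * psi k x ^ 2)
      + q_m * ∑ k ∈ Finset.range (n + 1), ∫ x, Real.exp (-x ^ 2) * psi k x ^ 2
      ≤ omega n / Real.pi * ((∫ x, q x) + q_m * √Real.pi) := by
    rw [Finset.mul_sum, ← Finset.sum_add_distrib, ← integral_exp_neg_sq, ← integral_const_mul,
      ← integral_add hq (integrable_exp_neg_sq.const_mul _), ← integral_const_mul]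
    have e : ∀ k, (∫ x, q x * psi k x ^ 2) + q_m * ∫ x, Real.exp (-x ^ 2) * psi k x ^ 2
        = ∫ x, (q x + q_m * Real.exp (-x ^ 2)) * psi k x ^ 2 := fun k => by
      rw [← integral_const_mul, ← integral_add (integrable_mul_psi_sq hq k)
        ((integrable_exp_mul_psi_sq k).const_mul _)]
      refine integral_congr_ae (Eventually.of_forall fun x => ?_)
      simp only
      ring
    have hi : Integrable fun x => q x + q_m * Real.exp (-x ^ 2) :=
      hq.add (integrable_exp_neg_sq.const_mul q_m)
    simp only [e]
    rw [← integral_finsetSum _ fun k _ => integrable_mul_psi_sq hi k]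
    refine integral_mono_ae (integrable_finsetSum _ fun k _ => integrable_mul_psi_sq hi k)
      (hi.const_mul _) ?_
    filter_upwards [hpos] with x hx
    rw [← Finset.mul_sum, mul_comm]
    exact mul_le_mul_of_nonneg_right (sum_psi_sq_le_omega n x) hx
  rw [sum_integral_exp_mul_psi_sq] at h1
  have h2 : omega n / Real.pi * (q_m * √Real.pi) = omega n * (q_m / √Real.pi) := by
    have h3 : √Real.pi * √Real.pi = Real.pi := Real.mul_self_sqrt Real.pi_pos.le
    have h4 : √Real.pi ≠ 0 := by positivity
    nth_rewrite 1 [← h3]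
    field_simp
  rw [mul_add, h2] at h1
  have h5 : epsilon n * (q_m / √Real.pi) = omega n * (q_m / √Real.pi)
      - q_m * (√2 * (Real.Gamma (n + 3 / 2) / Real.Gamma (n + 1)) / √Real.pi) := by
    unfold epsilon
    ring
  rw [h5]
  linarith

end Perturbed

end PerturbedOscillator

end

/-! ### Assembly of the theorem. -/

theorem theorem4p1 :
    (∀ (q : ℝ → ℝ) (q_m : ℝ), MeasureTheory.Integrable q MeasureTheory.volume → 0 ≤ q_m →
      (∀ᵐ x : ℝ, 0 ≤ q x + q_m * Real.exp (-x ^ 2)) →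
        (∃ lam : ℕ → ℝ, PerturbedOscillator.IsEigenvalueSequence (fun x => x ^ 2 + q x) lam) ∧
        ∀ lam : ℕ → ℝ, PerturbedOscillator.IsEigenvalueSequence (fun x => x ^ 2 + q x) lam →
          ∀ n : ℕ,
            ∑ k ∈ Finset.range (n + 1),
                (lam k - PerturbedOscillator.lam0 k
                  - 1 / (Real.pi * √(PerturbedOscillator.lam0 k)) * ∫ x, q x)
              ≤ PerturbedOscillator.chi n / Real.pi * (∫ x, q x)
                + PerturbedOscillator.epsilon n * (q_m / √Real.pi)) ∧
    (∀ n : ℕ, 0 ≤ PerturbedOscillator.epsilon n) ∧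
    (fun n : ℕ => PerturbedOscillator.epsilon n)
      =O[Filter.atTop] (fun n : ℕ => 1 / √(n : ℝ)) := by
  refine ⟨fun q q_m hq hm hpos =>
    ⟨PerturbedOscillator.exists_isEigenvalueSequence hq hm hpos, fun lam hlam n => ?_⟩,
    PerturbedOscillator.epsilon_nonneg, PerturbedOscillator.epsilon_isBigO⟩
  have h1 := PerturbedOscillator.sum_eigenvalues_le hq hm hpos hlam n
  have h2 := PerturbedOscillator.sum_integral_mul_psi_sq_le hq hpos n
  have h3 : ∑ k ∈ Finset.range (n + 1),
      1 / (Real.pi * √(PerturbedOscillator.lam0 k)) * ∫ x, q x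
      = (∑ k ∈ Finset.range (n + 1), 1 / √(PerturbedOscillator.lam0 k)) / Real.pi * ∫ x, q x := by
    rw [Finset.sum_div, Finset.sum_mul]
    refine Finset.sum_congr rfl fun k _ => ?_
    rw [div_div, mul_comm Real.pi]
  rw [Finset.sum_add_distrib] at h1
  rw [Finset.sum_sub_distrib, Finset.sum_sub_distrib, h3]
  -- Splitting `ω_n` into `χ_n` and `∑ 1 / √λ_k⁰` isolates the term subtracted from the eigenvalues
  -- in the statement.
  rw [PerturbedOscillator.omega, add_div, add_mul] at h2
  linarith
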